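/- Let $p=p(x_1,\dots,x_g)$ be a symmetric polynomial with real coefficients in $g$ noncommuting symmetric variables ($p^T=p$, where $T$ reverses words and fixes the variables), let $d=\deg p$, and let $p''(x)[h]=\frac{d^2}{dt^2}p(x+th)\big|_{t=0}$ be its Hessian. Let $V=\mathrm{col}(V_0,\dots,V_{d-2})$ be the border vector, with $V_j^T=[x_1\cdots x_g]\otimes\cdots\otimes[x_1\cdots x_g]\otimes[h_1\cdots h_g]$ ($j$ factors in $x$; the entries of the column $V_j$ are the transposes of the entries of this row), and let $Z(x)=[Z_{ij}(x)]_{i,j=0}^{d-2}$, with block $Z_{ij}$ of size $g^{i+1}\times g^{j+1}$ and entries polynomials in $x$, be the middle matrix, i.e. the matrix with $p''(x)[h]=V(x)[h]^TZ(x)V(x)[h]$. Let $\mathcal Z=Z(0)$ be the scalar middle matrix, with blocks $\mathcal Z_{ij}$ (read as $0$ if $i$ or $j$ exceeds $d-2$), and let $\mu_-(\mathcal Z)$ be the number of negative eigenvalues of $\mathcal Z$, counted with multiplicity. Notation: for a $g\times g^2$ matrix $C$, viewed as a $g\times g$ block matrix $[c_{ij}]$ with $c_{ij}\in\mathbb R^{1\times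 g}$, the structured transpose $C^{sT}$ is the block matrix with $ij$ entry $c_{ji}$; $\mathrm{vec}(A)$ stacks the columns of $A$, and $\mathrm{mat}_g$ is its inverse, from $\mathbb R^{g^2}$ to $\mathbb R^{g\times g}$. **(I)** If $d\ge 3$, then $\mu_-(\mathcal Z)=1$ if and only if $$\mathcal Z=\begin{bmatrix}\mathcal Z_{00}&\mathcal Z_{01}&\mathcal Z_{02}\\ \mathcal Z_{10}&\mathcal Z_{11}&0\\ \mathcal Z_{20}&0&0\end{bmatrix}$$ (that is, $\mathcal Z_{ij}=0$ for $i+j\ge 3$) and there are $u,y\in\mathbb R^g$, $v\in\mathbb R^{g^2}$ and $A=A^T\in\mathbb R^{g\times g}$ with $u^Tu=1$ and $(\mathrm{mat}_g v)u=0$ such that 1. $\mathcal Z_{01}=u(u^T\otimes y^T)+uv^T+(uv^T)^{sT}=\mathcal Z_{01}^{sT}$ and $\mathcal Z_{10}=\mathcal Z_{01}^T$; 2. $\mathcal Z_{11}=(u\otimes I_g)A(u\otimes I_g)^T$; 3. $\mathcal Z_{02}=u(u^T\otimes w_A^T)$ with $w_A=\mathrm{vec}(A)$, and $\mathcal Z_{20}=\mathcal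 Z_{02}^T$; 4. with $P=I_g-uu^T$, so that $A=(u\otimes I_g)^T\mathcal Z_{11}(u\otimes I_g)$, the matrix $$E_1=\begin{bmatrix}P\mathcal Z_{00}P&(\mathrm{mat}_g v)^T\\ \mathrm{mat}_g v&A\end{bmatrix}$$ is positive semidefinite. Moreover, if $d=3$, then for all such $u,y,v,A$ one has $A=0$, $w_A=0$ and $v=0$. **(II)** If $d=2$, then $\mu_-(\mathcal Z)=1$ if and only if $\mathcal Z_{ij}=0$ for $i+j\ge 1$ and there exists $u\in\mathbb R^g$ with $u^Tu=1$ such that $\mathcal Z_{00}u=\lambda u$ for some $\lambda<0$ and $P\mathcal Z_{00}P\succeq 0$ for $P=I_g-uu^T$. **(III)** $\mu_-(\mathcal Z)=0$ if and only if $\mathcal Z_{ij}=0$ for $i+j\ge 1$ and $\mathcal Z_{00}\succeq 0$. -/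

import Mathlib

open Matrix Polynomial

noncomputable section

namespace NCHessian

/-! ### Noncommutative polynomials -/

/-- Real polynomials in the noncommuting variables `x_1, …, x_g`.  Mathlib's `star` on the free
algebra is the involution `p ↦ pᵀ` that fixes the variables and reverses words. -/
abbrev NCPoly (g : ℕ) : Type := FreeAlgebra ℝ (Fin g)

/-- Real polynomials in the `2g` noncommuting variables `x_1, …, x_g` (the left summand) and
`h_1, …, h_g` (the right summand). -/
abbrev NCPolyXH (g : ℕ) : Type := FreeAlgebra ℝ (Fin g ⊕ Fin g)

/-- The variable `x_j`, among the variables `x, h`. -/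
def xVar {g : ℕ} (j : Fin g) : NCPolyXH g := FreeAlgebra.ι ℝ (Sum.inl j)

/-- The variable `h_j`, among the variables `x, h`. -/
def hVar {g : ℕ} (j : Fin g) : NCPolyXH g := FreeAlgebra.ι ℝ (Sum.inr j)

/-- A polynomial in `x`, viewed as a polynomial in `x, h`. -/
def incl (g : ℕ) : NCPoly g →ₐ[ℝ] NCPolyXH g := FreeAlgebra.lift ℝ xVar

/-- The degree: the maximal length of a word that appears in `p` (and `0` for `p = 0`). -/
def ncDegree {g : ℕ} (p : NCPoly g) : ℕ :=
  (FreeAlgebra.equivMonoidAlgebraFreeMonoid p).coeff.support.sup FreeMonoid.length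

/-- `p(x + t h)`, as a polynomial in the central variable `t` whose coefficients are
noncommutative polynomials in `x, h`. -/
def shift (g : ℕ) : NCPoly g →ₐ[ℝ] (NCPolyXH g)[X] :=
  FreeAlgebra.lift ℝ fun j => C (xVar j) + X * C (hVar j)

/-- The Hessian `p''(x)[h] = d²p(x + t h)/dt²` at `t = 0`. -/
def hessian {g : ℕ} (p : NCPoly g) : NCPolyXH g :=
  (derivative (derivative (shift g p))).eval 0

/-! ### Border vector and middle matrix -/

/-- The index set with `g ^ (j + 1)` elements of a `(j+1)`-fold Kronecker product
of `g`-vectors. -/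
@[reducible] def KIdx (g : ℕ) : ℕ → Type
  | 0 => Fin g
  | j + 1 => Fin g × KIdx g j

instance instFintypeKIdx (g : ℕ) : ∀ j, Fintype (KIdx g j)
  | 0 => inferInstanceAs (Fintype (Fin g))
  | j + 1 =>
    letI := instFintypeKIdx g j
    inferInstanceAs (Fintype (Fin g × KIdx g j))

instance instDecidableEqKIdx (g : ℕ) : ∀ j, DecidableEq (KIdx g j)
  | 0 => inferInstanceAs (DecidableEq (Fin g))
  | j + 1 =>
    letI := instDecidableEqKIdx g j
    inferInstanceAs (DecidableEq (Fin g × KIdx g j))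

/-- The row vector `V_jᵀ = [x_1 ⋯ x_g] ⊗ ⋯ ⊗ [x_1 ⋯ x_g] ⊗ [h_1 ⋯ h_g]` (`j` factors in `x`). -/
def borderRow (g : ℕ) : ∀ j, KIdx g j → NCPolyXH g
  | 0 => fun b => hVar b
  | j + 1 => fun b => xVar b.1 * borderRow g j b.2

/-- The index set of the border vector `V = col(V_0, …, V_{d-2})`. -/
abbrev BIdx (g d : ℕ) : Type := Σ i : Fin (d - 1), KIdx g i

/-- The row vector `Vᵀ`; the entries of the column `V` are the transposes of its entries. -/
def borderT (g d : ℕ) (a : BIdx g d) : NCPolyXH g := borderRow g a.1 a.2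

/-- `Z` is the middle matrix of the Hessian of `p`, where `d` is the degree of `p`:
its entries are polynomials in `x`, and `p''(x)[h] = V(x)[h]ᵀ Z(x) V(x)[h]`. -/
def IsMiddleMatrix {g : ℕ} (p : NCPoly g)
    (Z : Matrix (BIdx g (ncDegree p)) (BIdx g (ncDegree p)) (NCPoly g)) : Prop :=
  hessian p = ∑ a, ∑ b,
    borderT g (ncDegree p) a * incl g (Z a b) * star (borderT g (ncDegree p) b)

/-- The scalar matrix `Z(0)`: every entry is evaluated at `x = 0`. -/
def evalZero {g : ℕ} {m n : Type*} (Z : Matrix m n (NCPoly g)) : Matrix m n ℝ :=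
  Z.map (FreeAlgebra.lift ℝ (fun _ : Fin g => (0 : ℝ)))

/-- The block `𝒵_{ij}` (`i, j = 0, 1, 2, …`) of a matrix indexed as the border vector;
it is zero by convention if `i` or `j` exceeds `d - 2`. -/
def block {g d : ℕ} (S : Matrix (BIdx g d) (BIdx g d) ℝ) (i j : ℕ) :
    Matrix (KIdx g i) (KIdx g j) ℝ :=
  fun a b => if h : i < d - 1 ∧ j < d - 1 then S ⟨⟨i, h.1⟩, a⟩ ⟨⟨j, h.2⟩, b⟩ else 0

/-- The number `μ₋` of negative eigenvalues, counted with multiplicity,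
of a (symmetric) real matrix. -/
def muMinus {n : Type*} [Fintype n] [DecidableEq n] (S : Matrix n n ℝ) : ℕ :=
  S.charpoly.roots.countP (fun t => t < 0)

/-! ### Matrix notation -/

/-- The Kronecker product `u ⊗ y` of two column vectors. -/
def kronVec {g : ℕ} (u y : Fin g → ℝ) : Fin g × Fin g → ℝ := fun k => u k.1 * y k.2

/-- The Kronecker product `u ⊗ w` of a `g`-vector and a `g²`-vector. -/
def kronVec₃ {g : ℕ} (u : Fin g → ℝ) (w : Fin g × Fin g → ℝ) : Fin g × Fin g × Fin g → ℝ :=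
  fun k => u k.1 * w k.2

/-- The `g² × g` matrix `u ⊗ I_g`. -/
def kronOne {g : ℕ} (u : Fin g → ℝ) : Matrix (Fin g × Fin g) (Fin g) ℝ :=
  Matrix.of fun k l => u k.1 * (1 : Matrix (Fin g) (Fin g) ℝ) k.2 l

/-- `mat_g w`: the matrix whose columns are the `g` consecutive pieces of length `g` of `w`;
inverse to `Matrix.vec`. -/
def matG {g : ℕ} (w : Fin g × Fin g → ℝ) : Matrix (Fin g) (Fin g) ℝ :=
  Matrix.of fun i j => w (j, i)

/-- The structured transpose of a `g × g²` matrix, seen as a `g × g` block matrix whose blocks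
are rows of length `g`: the blocks are permuted, and not transposed themselves. -/
def structT {g : ℕ} (S : Matrix (Fin g) (Fin g × Fin g) ℝ) : Matrix (Fin g) (Fin g × Fin g) ℝ :=
  Matrix.of fun i k => S k.1 (i, k.2)

/-- The matrix `P = I_g - u uᵀ`. -/
def projPerp {g : ℕ} (u : Fin g → ℝ) : Matrix (Fin g) (Fin g) ℝ := 1 - vecMulVec u u

section Blocks

variable {g d : ℕ} (S : Matrix (BIdx g d) (BIdx g d) ℝ)

/-- `𝒵₀₀` -/
def block00 : Matrix (Fin g) (Fin g) ℝ := block S 0 0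
/-- `𝒵₀₁` -/
def block01 : Matrix (Fin g) (Fin g × Fin g) ℝ := block S 0 1
/-- `𝒵₁₀` -/
def block10 : Matrix (Fin g × Fin g) (Fin g) ℝ := block S 1 0
/-- `𝒵₁₁` -/
def block11 : Matrix (Fin g × Fin g) (Fin g × Fin g) ℝ := block S 1 1
/-- `𝒵₀₂` -/
def block02 : Matrix (Fin g) (Fin g × Fin g × Fin g) ℝ := block S 0 2
/-- `𝒵₂₀` -/
def block20 : Matrix (Fin g × Fin g × Fin g) (Fin g) ℝ := block S 2 0

end Blocks

/-- The matrix `E₁ = [P 𝒵₀₀ P, (mat_g v)ᵀ; mat_g v, A]`. -/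
def matE1 {g d : ℕ} (S : Matrix (BIdx g d) (BIdx g d) ℝ) (u : Fin g → ℝ)
    (v : Fin g × Fin g → ℝ) (A : Matrix (Fin g) (Fin g) ℝ) :
    Matrix (Fin g ⊕ Fin g) (Fin g ⊕ Fin g) ℝ :=
  Matrix.fromBlocks (projPerp u * block00 S * projPerp u) (matG v)ᵀ (matG v) A

/-- The form of the scalar middle matrix with data `u, y, v, A`. -/
structure HasForm {g d : ℕ} (S : Matrix (BIdx g d) (BIdx g d) ℝ) (u y : Fin g → ℝ)
    (v : Fin g × Fin g → ℝ) (A : Matrix (Fin g) (Fin g) ℝ) : Prop where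
  /-- All blocks other than `𝒵₀₀, 𝒵₀₁, 𝒵₁₀, 𝒵₁₁, 𝒵₀₂, 𝒵₂₀` vanish. -/
  shape : ∀ i j, 3 ≤ i + j → block S i j = 0
  z01 : block01 S = vecMulVec u (kronVec u y) + vecMulVec u v + structT (vecMulVec u v)
  z01_symm : structT (block01 S) = block01 S
  z10 : block10 S = (block01 S)ᵀ
  z11 : block11 S = kronOne u * A * (kronOne u)ᵀ
  z02 : block02 S = vecMulVec u (kronVec₃ u A.vec)
  z20 : block20 S = (block02 S)ᵀ
  unit : u ⬝ᵥ u = 1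
  v_perp : matG v *ᵥ u = 0
  A_symm : Aᵀ = A
  A_eq : A = (kronOne u)ᵀ * block11 S * kronOne u
  E1_psd : (matE1 S u v A).PosSemidef

/-! ### Existence of the middle matrix -/

/-- The products `x_{a_1} ⋯ x_{a_i} h_b m(x) h_c x_{c_j} ⋯ x_{c_1}` with `i + j + 2 ≤ n`. -/
def twoH (g n : ℕ) : Set (NCPolyXH g) :=
  {q | ∃ (i j : ℕ) (a : KIdx g i) (b : KIdx g j) (m : NCPoly g), i + j + 2 ≤ n ∧
    q = borderRow g i a * incl g m * star (borderRow g j b)}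

/-- The products `m(x) h_c x_{c_j} ⋯ x_{c_1}` with `j + 1 ≤ n`. -/
def oneH (g n : ℕ) : Set (NCPolyXH g) :=
  {q | ∃ (j : ℕ) (b : KIdx g j) (m : NCPoly g), j + 1 ≤ n ∧
    q = incl g m * star (borderRow g j b)}

theorem star_border_mul_word {g : ℕ} (l : List (Fin g)) : ∀ (j : ℕ) (b : KIdx g j),
    ∃ (k : ℕ) (c : KIdx g k), k = j + l.length ∧
      star (borderRow g j b) * (l.map xVar).prod = star (borderRow g k c) := by
  induction l with
  | nil => intro j b; exact ⟨j, b, by simp, by simp⟩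
  | cons a l ih =>
    intro j b
    obtain ⟨k, c, hk, h⟩ := ih (j + 1) (a, b)
    refine ⟨k, c, by simp only [List.length_cons]; omega, ?_⟩
    rw [← h]
    simp [borderRow, xVar, mul_assoc]

theorem shift_cons {g : ℕ} (a : Fin g) (l : List (Fin g)) :
    shift g (((a :: l).map (FreeAlgebra.ι ℝ)).prod) =
      C (xVar a) * shift g ((l.map (FreeAlgebra.ι ℝ)).prod) +
        X * (C (hVar a) * shift g ((l.map (FreeAlgebra.ι ℝ)).prod)) := by
  rw [List.map_cons, List.prod_cons, map_mul]
  nth_rewrite 1 [shift]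
  rw [FreeAlgebra.lift_ι_apply, add_mul, mul_assoc]

theorem shift_coeff_zero {g : ℕ} (l : List (Fin g)) :
    (shift g ((l.map (FreeAlgebra.ι ℝ)).prod)).coeff 0 = (l.map xVar).prod := by
  induction l with
  | nil => simp
  | cons a l ih => rw [shift_cons]; simp [ih]

theorem shift_coeff_one {g : ℕ} (l : List (Fin g)) :
    (shift g ((l.map (FreeAlgebra.ι ℝ)).prod)).coeff 1 ∈
      Submodule.span ℝ (oneH g l.length) := by
  induction l with
  | nil => simp [coeff_one]
  | cons a l ih =>
    rw [shift_cons, coeff_add, coeff_C_mul, coeff_X_mul, coeff_C_mul, shift_coeff_zero]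
    refine Submodule.add_mem _ ?_ ?_
    · refine Submodule.span_induction (p := fun q _ => xVar a * q ∈
        Submodule.span ℝ (oneH g (a :: l).length)) ?_ ?_ ?_ ?_ ih
      · rintro q ⟨j, b, m, hj, rfl⟩
        refine Submodule.subset_span ⟨j, b, FreeAlgebra.ι ℝ a * m,
          by simp only [List.length_cons]; omega, ?_⟩
        simp [incl, mul_assoc]
      · simp
      · intro q r _ _ hq hr; rw [mul_add]; exact Submodule.add_mem _ hq hr
      · intro t q _ hq; rw [mul_smul_comm]; exact Submodule.smul_mem _ _ hq
    · obtain ⟨k, c, hk, h⟩ := star_border_mul_word l 0 a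
      refine Submodule.subset_span ⟨k, c, 1, by simp only [List.length_cons]; omega, ?_⟩
      rw [← h]
      simp [borderRow, hVar]

theorem shift_coeff_two {g : ℕ} (l : List (Fin g)) :
    (shift g ((l.map (FreeAlgebra.ι ℝ)).prod)).coeff 2 ∈
      Submodule.span ℝ (twoH g l.length) := by
  induction l with
  | nil => simp [coeff_one]
  | cons a l ih =>
    rw [shift_cons, coeff_add, coeff_C_mul, coeff_X_mul, coeff_C_mul]
    refine Submodule.add_mem _ ?_ ?_
    · refine Submodule.span_induction (p := fun q _ => xVar a * q ∈
        Submodule.span ℝ (twoH g (a :: l).length)) ?_ ?_ ?_ ?_ ih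
      · rintro q ⟨i, j, c, b, m, hj, rfl⟩
        refine Submodule.subset_span ⟨i + 1, j, (a, c), b, m,
          by simp only [List.length_cons]; omega, ?_⟩
        simp [borderRow, mul_assoc]
      · simp
      · intro q r _ _ hq hr; rw [mul_add]; exact Submodule.add_mem _ hq hr
      · intro t q _ hq; rw [mul_smul_comm]; exact Submodule.smul_mem _ _ hq
    · refine Submodule.span_induction (p := fun q _ => hVar a * q ∈
        Submodule.span ℝ (twoH g (a :: l).length)) ?_ ?_ ?_ ?_ (shift_coeff_one l)
      · rintro q ⟨j, b, m, hj, rfl⟩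
        refine Submodule.subset_span ⟨0, j, a, b, m,
          by simp only [List.length_cons]; omega, ?_⟩
        simp [borderRow, mul_assoc]
      · simp
      · intro q r _ _ hq hr; rw [mul_add]; exact Submodule.add_mem _ hq hr
      · intro t q _ hq; rw [mul_smul_comm]; exact Submodule.smul_mem _ _ hq

theorem hessian_eq_coeff {g : ℕ} (p : NCPoly g) :
    hessian p = (2 : ℝ) • (shift g p).coeff 2 := by
  rw [hessian, ← coeff_zero_eq_eval_zero, coeff_derivative, coeff_derivative, two_smul]
  norm_num
  rw [mul_two]

theorem poly_eq_sum {g : ℕ} (p : NCPoly g) :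
    p = ∑ w ∈ (FreeAlgebra.equivMonoidAlgebraFreeMonoid p).coeff.support,
      (FreeAlgebra.equivMonoidAlgebraFreeMonoid p).coeff w •
        ((FreeMonoid.toList w).map (FreeAlgebra.ι ℝ)).prod := by
  apply FreeAlgebra.equivMonoidAlgebraFreeMonoid.injective
  rw [map_sum]
  conv_lhs => rw [← MonoidAlgebra.sum_coeff_single (FreeAlgebra.equivMonoidAlgebraFreeMonoid p)]
  refine Finset.sum_congr rfl fun w _ => ?_
  rw [map_smul]
  have key : ∀ w : FreeMonoid (Fin g), FreeAlgebra.equivMonoidAlgebraFreeMonoid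
      (((FreeMonoid.toList w).map (FreeAlgebra.ι ℝ)).prod) =
      MonoidAlgebra.single (R := ℝ) w 1 := by
    intro w
    induction w using FreeMonoid.inductionOn' with
    | one => simp [MonoidAlgebra.one_def]
    | of_mul a w ih =>
      rw [FreeMonoid.toList_of_mul, List.map_cons, List.prod_cons, map_mul, ih]
      simp [FreeAlgebra.equivMonoidAlgebraFreeMonoid, MonoidAlgebra.single_mul_single]
  rw [key, MonoidAlgebra.smul_single]
  simp

/-- Every nc polynomial has a middle matrix. -/
theorem exists_isMiddleMatrix {g : ℕ} (p : NCPoly g) : ∃ Z, IsMiddleMatrix p Z := by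
  have key : hessian p ∈ Submodule.span ℝ (twoH g (ncDegree p)) := by
    rw [hessian_eq_coeff]
    refine Submodule.smul_mem _ _ ?_
    have hs := congrArg (fun q => (shift g q).coeff 2) (poly_eq_sum p)
    rw [hs, map_sum, finsetSum_coeff]
    refine Submodule.sum_mem _ fun w hw => ?_
    rw [map_smul, coeff_smul]
    refine Submodule.smul_mem _ _ ?_
    refine Submodule.span_mono ?_ (shift_coeff_two (FreeMonoid.toList w))
    rintro q ⟨i, j, a, b, m, h, rfl⟩
    refine ⟨i, j, a, b, m, h.trans ?_, rfl⟩
    exact Finset.le_sup (f := FreeMonoid.length) hw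
  unfold IsMiddleMatrix
  refine Submodule.span_induction (p := fun q _ => ∃ Z : Matrix (BIdx g (ncDegree p))
    (BIdx g (ncDegree p)) (NCPoly g), q = ∑ a, ∑ b,
    borderT g (ncDegree p) a * incl g (Z a b) * star (borderT g (ncDegree p) b)) ?_ ?_ ?_ ?_ key
  · rintro q ⟨i, j, a, b, m, h, rfl⟩
    refine ⟨Matrix.single ⟨⟨i, by omega⟩, a⟩ ⟨⟨j, by omega⟩, b⟩ m, ?_⟩
    rw [Finset.sum_eq_single ⟨⟨i, by omega⟩, a⟩, Finset.sum_eq_single ⟨⟨j, by omega⟩, b⟩]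
    · simp [borderT]
    · intro c _ hc
      rw [Matrix.single_apply_of_ne _ _ _ _ _ (by tauto)]; simp
    · simp
    · intro c _ hc
      refine Finset.sum_eq_zero fun e _ => ?_
      rw [Matrix.single_apply_of_ne _ _ _ _ _ (by tauto)]; simp
    · simp
  · exact ⟨0, by simp⟩
  · rintro q r _ _ ⟨Z, hZ⟩ ⟨W, hW⟩
    exact ⟨Z + W, by simp [hZ, hW, mul_add, add_mul, Finset.sum_add_distrib]⟩
  · rintro t q _ ⟨Z, hZ⟩
    exact ⟨t • Z, by simp [hZ, Finset.smul_sum]⟩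

end NCHessian

end

noncomputable section

namespace NCHessian

/-! ### Negative eigenvalues of symmetric matrices -/

section Spectral

variable {n : Type*} [Fintype n] [DecidableEq n] {S : Matrix n n ℝ}

/-! The word `V_aᵀ m V_b` ends its left border at the first `h` and starts its right border at the
second, so `a`, `m`, `b` can be read off from it. At `x = 0` only the empty `m` survives, so the
entry of `𝒵` at `(a, b)` is twice the coefficient in `p` of the word `a` followed by the reverse of
`b` (`evalZero_apply`). Hence `𝒵_{ij} = 0` for `i + j + 2 > d`, while the blocks with `i + j + 2 =
d` do not vanish; `pᵀ = p` makes the coefficients palindromic.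

Let `d ≥ 3` and `μ₋ = 1`. A basis vector `f` of the last block is isotropic, and `𝒵 f` lives in the
leading block, where it is a column `c` of `𝒵_{0,d-2}`, chosen nonzero. A form with one negative
eigenvalue is nonnegative on the orthogonal complement of such an `f`
(`nonneg_of_orthogonal_isotropic`), that is, where the leading block is orthogonal to `u = c / |c|`.
On this hyperplane null vectors lie in the kernel (`dotProduct_mulVec_eq_zero_of_null`). Zero
diagonal blocks then force `d ≤ 4` and make `u` split off both ends of the words of length four; the
null vectors of `𝒵₁₁` give the shape of `𝒵₀₁`. What remains of the form on the hyperplane is the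
form of `E₁`.

Conversely, `E₁ ⪰ 0` makes the form nonnegative on a hyperplane, so `μ₋ ≤ 1`
(`muMinus_le_one_of_hyperplane`), and `μ₋ = 0` would contradict `𝒵_{0,d-2} ≠ 0`. -/

theorem dotProduct_mulVec_comm_of_symm {n : Type*} [Fintype n] {S : Matrix n n ℝ}
    (hS : Sᵀ = S) (x y : n → ℝ) :
    x ⬝ᵥ S *ᵥ y = y ⬝ᵥ S *ᵥ x := by
  rw [dotProduct_mulVec, ← mulVec_transpose, hS, dotProduct_comm]

theorem posSemidef_iff_quadratic {n : Type*} [Fintype n] {S : Matrix n n ℝ} (hS : Sᵀ = S) :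
    S.PosSemidef ↔ ∀ x : n → ℝ, 0 ≤ x ⬝ᵥ S *ᵥ x := by
  rw [posSemidef_iff_dotProduct_mulVec]
  refine ⟨fun h x => by simpa using h.2 x, fun h => ⟨?_, fun x => by simpa using h x⟩⟩
  rw [IsHermitian, conjTranspose_eq_transpose_of_trivial, hS]

/-- An orthonormal basis of eigenvectors, with the count of the negative eigenvalues. -/
theorem exists_eigenbasis (hS : Sᵀ = S) : ∃ (w : n → n → ℝ) (ev : n → ℝ),
    (∀ i j, w i ⬝ᵥ w j = if i = j then 1 else 0) ∧ (∀ i, S *ᵥ w i = ev i • w i) ∧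
    (∀ x, x ⬝ᵥ S *ᵥ x = ∑ i, ev i * (w i ⬝ᵥ x) ^ 2) ∧
    muMinus S = (Finset.univ.filter fun i => ev i < 0).card ∧
    (S.PosSemidef ↔ ∀ i, 0 ≤ ev i) := by
  have hH : S.IsHermitian := by
    rw [IsHermitian, conjTranspose_eq_transpose_of_trivial, hS]
  have hdot : ∀ x y : EuclideanSpace ℝ n, inner ℝ x y = (x : n → ℝ) ⬝ᵥ (y : n → ℝ) := by
    intro x y
    rw [EuclideanSpace.inner_eq_star_dotProduct, star_trivial, dotProduct_comm]
  refine ⟨fun i => hH.eigenvectorBasis i, hH.eigenvalues, ?_, hH.mulVec_eigenvectorBasis, ?_, ?_,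
    hH.posSemidef_iff_eigenvalues_nonneg⟩
  · intro i j
    rw [← hdot, orthonormal_iff_ite.mp hH.eigenvectorBasis.orthonormal]
  · intro x
    have hx : x = ∑ i, ((hH.eigenvectorBasis i : n → ℝ) ⬝ᵥ x) •
        (hH.eigenvectorBasis i : n → ℝ) := by
      have h := congrArg (fun z : EuclideanSpace ℝ n => (z : n → ℝ))
        (hH.eigenvectorBasis.sum_repr' (WithLp.toLp 2 x))
      simp only [hdot, WithLp.ofLp_sum, WithLp.ofLp_smul] at h
      exact h.symm
    have hSx : S *ᵥ x = ∑ i, ((hH.eigenvectorBasis i : n → ℝ) ⬝ᵥ x) •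
        (hH.eigenvalues i • (hH.eigenvectorBasis i : n → ℝ)) := by
      conv_lhs => rw [hx]
      rw [Matrix.mulVec_sum]
      refine Finset.sum_congr rfl fun i _ => ?_
      rw [Matrix.mulVec_smul, hH.mulVec_eigenvectorBasis]
    rw [hSx, dotProduct_sum]
    refine Finset.sum_congr rfl fun i _ => ?_
    rw [dotProduct_smul, dotProduct_smul, dotProduct_comm x]
    simp only [smul_eq_mul]
    ring
  · rw [muMinus, hH.roots_charpoly_eq_eigenvalues, Multiset.countP_map]
    rfl

theorem muMinus_eq_zero_iff (hS : Sᵀ = S) : muMinus S = 0 ↔ S.PosSemidef := by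
  obtain ⟨w, ev, -, -, -, hmu, hpsd⟩ := exists_eigenbasis hS
  rw [hmu, hpsd, Finset.card_eq_zero, Finset.filter_eq_empty_iff]
  simp

/-- Two orthogonal eigenvectors with negative eigenvalues would span a plane on which the form is
negative definite, and this plane meets the hyperplane in a nonzero vector. -/
theorem muMinus_le_one_of_hyperplane (hS : Sᵀ = S) (f : n → ℝ)
    (h : ∀ x, f ⬝ᵥ x = 0 → 0 ≤ x ⬝ᵥ S *ᵥ x) : muMinus S ≤ 1 := by
  obtain ⟨w, ev, hw, hev, -, hmu, -⟩ := exists_eigenbasis hS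
  rw [hmu, Finset.card_le_one]
  intro i hi j hj
  simp only [Finset.mem_filter, Finset.mem_univ, true_and] at hi hj
  by_contra hij
  have key : ∀ a b : ℝ, f ⬝ᵥ (a • w i + b • w j) = 0 → 0 ≤ a ^ 2 * ev i + b ^ 2 * ev j := by
    intro a b hab
    have := h _ hab
    simp only [mulVec_add, mulVec_smul, hev, dotProduct_add, add_dotProduct, dotProduct_smul,
      smul_dotProduct, hw, if_neg hij, if_neg (Ne.symm hij), if_true, smul_eq_mul] at this
    linarith
  by_cases hfi : f ⬝ᵥ w i = 0
  · have := key 1 0 (by simp [hfi])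
    linarith
  · have := key (f ⬝ᵥ w j) (-(f ⬝ᵥ w i)) (by
      simp only [dotProduct_add, dotProduct_smul, smul_eq_mul]; ring)
    have h1 : 0 < (-(f ⬝ᵥ w i)) ^ 2 := sq_pos_of_ne_zero (neg_ne_zero.2 hfi)
    nlinarith [sq_nonneg (f ⬝ᵥ w j)]

theorem muMinus_eq_one_iff (hS : Sᵀ = S) :
    muMinus S = 1 ↔ ∃ u : n → ℝ, u ⬝ᵥ u = 1 ∧ (∃ lam : ℝ, lam < 0 ∧ S *ᵥ u = lam • u) ∧
      ∀ x, u ⬝ᵥ x = 0 → 0 ≤ x ⬝ᵥ S *ᵥ x := by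
  constructor
  · intro h1
    obtain ⟨w, ev, hw, hev, hq, hmu, -⟩ := exists_eigenbasis hS
    rw [hmu, Finset.card_eq_one] at h1
    obtain ⟨k, hk⟩ := h1
    have hk' : ∀ i, ev i < 0 ↔ i = k := by
      intro i
      simpa using congrArg (fun s => i ∈ s) hk
    refine ⟨w k, by rw [hw, if_pos rfl], ⟨ev k, (hk' k).2 rfl, hev k⟩, fun x hx => ?_⟩
    rw [hq]
    refine Finset.sum_nonneg fun i _ => ?_
    by_cases hik : i = k
    · rw [hik, hx]; simp
    · exact mul_nonneg (not_lt.1 fun h => hik ((hk' i).1 h)) (sq_nonneg _)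
  · rintro ⟨u, hu, ⟨lam, hlam, hSu⟩, h⟩
    have hle := muMinus_le_one_of_hyperplane hS u h
    have hne : muMinus S ≠ 0 := by
      rw [Ne, muMinus_eq_zero_iff hS, posSemidef_iff_quadratic hS]
      intro hpos
      have := hpos u
      rw [hSu, dotProduct_smul, hu, smul_eq_mul] at this
      linarith
    omega

/-- If there is one negative eigenvalue, then the form is nonnegative on the orthogonal complement
of any isotropic vector outside the kernel. -/
theorem nonneg_of_orthogonal_isotropic (hS : Sᵀ = S) (h1 : muMinus S = 1) {f e : n → ℝ}
    (hf : f ⬝ᵥ S *ᵥ f = 0) (he : e ⬝ᵥ S *ᵥ f ≠ 0) {x : n → ℝ} (hx : x ⬝ᵥ S *ᵥ f = 0) :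
    0 ≤ x ⬝ᵥ S *ᵥ x := by
  obtain ⟨u, -, -, hu⟩ := (muMinus_eq_one_iff hS).1 h1
  by_contra! hneg
  set q := x ⬝ᵥ S *ᵥ x with hq
  set t := e ⬝ᵥ S *ᵥ x with ht
  set r := e ⬝ᵥ S *ᵥ f with hr
  set m := e ⬝ᵥ S *ᵥ e with hm
  -- the form takes the value `t² / q - 1` at `e + s f`
  let s := (t ^ 2 / q - 1 - m) / (2 * r)
  have hs : m + 2 * s * r = t ^ 2 / q - 1 := by
    simp only [s]; field_simp; ring
  have key : ∀ a b : ℝ, u ⬝ᵥ (a • x + b • (e + s • f)) = 0 →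
      0 ≤ a ^ 2 * q + 2 * a * b * t + b ^ 2 * (t ^ 2 / q - 1) := by
    intro a b hab
    have := hu _ hab
    simp only [mulVec_add, mulVec_smul, dotProduct_add, add_dotProduct, dotProduct_smul,
      smul_dotProduct, smul_eq_mul, hf, hx, dotProduct_mulVec_comm_of_symm hS f x,
      dotProduct_mulVec_comm_of_symm hS x e, dotProduct_mulVec_comm_of_symm hS f e,
      ← hq, ← ht, ← hr, ← hm] at this
    rw [← hs]
    linarith
  have key' : ∀ a b : ℝ, u ⬝ᵥ (a • x + b • (e + s • f)) = 0 → a = 0 ∧ b = 0 := by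
    intro a b hab
    have h0 := key a b hab
    -- Completing the square, with `q < 0`, shows that the form is negative definite on the span of
    -- `x` and `e + s f`.
    have h2 : a ^ 2 * q + 2 * a * b * t + b ^ 2 * (t ^ 2 / q - 1) =
        q * (a + b * t / q) ^ 2 - b ^ 2 := by
      have hq0 := hneg.ne
      field_simp
      ring
    rw [h2] at h0
    have h3 : q * (a + b * t / q) ^ 2 ≤ 0 := mul_nonpos_of_nonpos_of_nonneg hneg.le (sq_nonneg _)
    have hb : b = 0 := by
      have : b ^ 2 = 0 := le_antisymm (by linarith) (sq_nonneg b)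
      simpa using this
    subst hb
    refine ⟨?_, rfl⟩
    by_contra ha
    have : 0 < a ^ 2 := by positivity
    simp only [zero_mul, zero_div, add_zero] at h0
    nlinarith
  -- This combination lies in the intersection of the span with `uᗮ`. Its vanishing coefficients put
  -- `x` itself in `uᗮ`, against `key'`.
  have h3 := key' (u ⬝ᵥ (e + s • f)) (-(u ⬝ᵥ x)) (by
    rw [dotProduct_add, dotProduct_smul, dotProduct_smul]; simp only [smul_eq_mul]; ring)
  have h4 := key' 1 0 (by simpa using h3.2)
  exact one_ne_zero h4.1

/-- A null vector of a form that is nonnegative on a subspace is in its kernel. -/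
theorem dotProduct_mulVec_eq_zero_of_null {n : Type*} [Fintype n] {S : Matrix n n ℝ}
    (hS : Sᵀ = S) {W : Submodule ℝ (n → ℝ)}
    (hW : ∀ x ∈ W, 0 ≤ x ⬝ᵥ S *ᵥ x) {f x : n → ℝ} (hfW : f ∈ W) (hxW : x ∈ W)
    (hf : f ⬝ᵥ S *ᵥ f = 0) : x ⬝ᵥ S *ᵥ f = 0 := by
  have key : ∀ t : ℝ, 0 ≤ x ⬝ᵥ S *ᵥ x + 2 * t * (x ⬝ᵥ S *ᵥ f) := by
    intro t
    have := hW (x + t • f) (W.add_mem hxW (W.smul_mem t hfW))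
    simp only [mulVec_add, mulVec_smul, dotProduct_add, add_dotProduct, dotProduct_smul,
      smul_dotProduct, smul_eq_mul, hf, dotProduct_mulVec_comm_of_symm hS f x] at this
    linarith
  by_contra hne
  -- The affine function of `t` in `key` takes the value `-1` here.
  have := key (-(x ⬝ᵥ S *ᵥ x + 1) / (2 * (x ⬝ᵥ S *ᵥ f)))
  have h2 : 2 * (-(x ⬝ᵥ S *ᵥ x + 1) / (2 * (x ⬝ᵥ S *ᵥ f))) * (x ⬝ᵥ S *ᵥ f) =
      -(x ⬝ᵥ S *ᵥ x + 1) := by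
    field_simp
  linarith

theorem muMinus_reindex {m : Type*} [Fintype m] [DecidableEq m] (e : n ≃ m) :
    muMinus (Matrix.reindex e e S) = muMinus S := by
  rw [muMinus, muMinus, Matrix.charpoly_reindex]

end Spectral

/-! ### Coefficients of noncommutative polynomials -/

section Coefficients

/-- The word `l` as a monomial. -/
def monom {X : Type*} (l : List X) : FreeAlgebra ℝ X := (l.map (FreeAlgebra.ι ℝ)).prod

/-- The coefficient of the word `l`. -/
def wordCoeff {X : Type*} (l : List X) : FreeAlgebra ℝ X →ₗ[ℝ] ℝ where
  toFun p := (FreeAlgebra.equivMonoidAlgebraFreeMonoid p).coeff (FreeMonoid.ofList l)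
  map_add' p q := by simp
  map_smul' t p := by simp

theorem monom_nil {X : Type*} : monom ([] : List X) = 1 := rfl

theorem monom_cons {X : Type*} (a : X) (l : List X) :
    monom (a :: l) = FreeAlgebra.ι ℝ a * monom l := by simp [monom]

theorem monom_append {X : Type*} (l m : List X) : monom (l ++ m) = monom l * monom m := by
  simp [monom]

theorem equiv_monom {X : Type*} (l : List X) :
    FreeAlgebra.equivMonoidAlgebraFreeMonoid (monom l) =
      MonoidAlgebra.single (R := ℝ) (FreeMonoid.ofList l) 1 := by
  induction l with
  | nil => simp [monom, MonoidAlgebra.one_def]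
  | cons a l ih =>
    rw [monom_cons, map_mul, ih]
    simp [FreeAlgebra.equivMonoidAlgebraFreeMonoid, MonoidAlgebra.single_mul_single]

theorem wordCoeff_monom {X : Type*} [DecidableEq X] (l m : List X) :
    wordCoeff l (monom m) = if m = l then 1 else 0 := by
  classical
  simp only [wordCoeff, LinearMap.coe_mk, AddHom.coe_mk, equiv_monom]
  rw [MonoidAlgebra.coeff_single, Finsupp.single_apply]
  simp

theorem poly_eq_sum_monom {X : Type*} (p : FreeAlgebra ℝ X) :
    p = ∑ w ∈ (FreeAlgebra.equivMonoidAlgebraFreeMonoid p).coeff.support,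
      wordCoeff (FreeMonoid.toList w) p • monom (FreeMonoid.toList w) := by
  apply FreeAlgebra.equivMonoidAlgebraFreeMonoid.injective
  rw [map_sum]
  conv_lhs => rw [← MonoidAlgebra.sum_coeff_single (FreeAlgebra.equivMonoidAlgebraFreeMonoid p)]
  refine Finset.sum_congr rfl fun w _ => ?_
  rw [map_smul, equiv_monom, MonoidAlgebra.smul_single]
  simp [wordCoeff]

/-- Linear maps that agree on all words are equal. -/
theorem linearMap_ext_monom {X M : Type*} [AddCommGroup M] [Module ℝ M]
    {φ ψ : FreeAlgebra ℝ X →ₗ[ℝ] M} (h : ∀ l, φ (monom l) = ψ (monom l))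
    (p : FreeAlgebra ℝ X) : φ p = ψ p := by
  rw [poly_eq_sum_monom p]
  simp only [map_sum, map_smul, h]

theorem star_monom {X : Type*} (l : List X) : star (monom l) = monom l.reverse := by
  induction l with
  | nil => simp [monom]
  | cons a l ih =>
    rw [monom_cons, star_mul, ih, FreeAlgebra.star_ι, List.reverse_cons, monom_append, monom_cons,
      monom_nil, mul_one]

theorem wordCoeff_star {g : ℕ} (l : List (Fin g)) (p : NCPoly g) :
    wordCoeff l (star p) = wordCoeff l.reverse p := by
  let st : NCPoly g →ₗ[ℝ] NCPoly g :=
    { toFun := star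
      map_add' := star_add
      map_smul' := fun t q => by
        rw [Algebra.smul_def, star_mul, FreeAlgebra.star_algebraMap, RingHom.id_apply,
          ← Algebra.commutes, ← Algebra.smul_def] }
  refine linearMap_ext_monom (φ := (wordCoeff l).comp st) (ψ := wordCoeff l.reverse) (fun m => ?_) p
  simp only [LinearMap.comp_apply, LinearMap.coe_mk, AddHom.coe_mk, st, star_monom,
    wordCoeff_monom, List.reverse_eq_iff]

theorem wordCoeff_eq_zero_of_ncDegree_lt {g : ℕ} {p : NCPoly g} {l : List (Fin g)}
    (h : ncDegree p < l.length) : wordCoeff l p = 0 := by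
  by_contra hne
  have := Finset.le_sup (f := FreeMonoid.length) (Finsupp.mem_support_iff.2 hne)
  exact absurd (this : l.length ≤ ncDegree p) (not_le.2 h)

theorem exists_wordCoeff_ne_zero {g : ℕ} {p : NCPoly g} (h : 0 < ncDegree p) :
    ∃ l : List (Fin g), l.length = ncDegree p ∧ wordCoeff l p ≠ 0 := by
  have hne : (FreeAlgebra.equivMonoidAlgebraFreeMonoid p).coeff.support.Nonempty := by
    rw [Finset.nonempty_iff_ne_empty]
    intro h0
    rw [ncDegree, h0] at h
    simp at h
  obtain ⟨w, hw, hd⟩ := Finset.exists_mem_eq_sup _ hne FreeMonoid.length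
  exact ⟨FreeMonoid.toList w, hd.symm, Finsupp.mem_support_iff.1 hw⟩

/-- The word in `x` that arises from a word in `x, h` by replacing every `h_j` by `x_j`. -/
def mergeWord {g : ℕ} (W : List (Fin g ⊕ Fin g)) : List (Fin g) := W.map (Sum.elim id id)

theorem wordCoeff_cons_ι_mul {X : Type*} [DecidableEq X] (a b : X) (W : List X)
    (q : FreeAlgebra ℝ X) :
    wordCoeff (b :: W) (FreeAlgebra.ι ℝ a * q) = if a = b then wordCoeff W q else 0 := by
  refine (linearMap_ext_monom
    (φ := (wordCoeff (b :: W)).comp (LinearMap.mulLeft ℝ (FreeAlgebra.ι ℝ a)))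
    (ψ := if a = b then wordCoeff W else 0) (fun m => ?_) q).trans ?_
  · rw [LinearMap.comp_apply, LinearMap.mulLeft_apply, ← monom_cons, wordCoeff_monom]
    by_cases h : a = b <;> simp [h, wordCoeff_monom]
  · split_ifs <;> rfl

theorem wordCoeff_nil_ι_mul {X : Type*} (a : X) (q : FreeAlgebra ℝ X) :
    wordCoeff [] (FreeAlgebra.ι ℝ a * q) = 0 := by
  classical
  refine linearMap_ext_monom
    (φ := (wordCoeff []).comp (LinearMap.mulLeft ℝ (FreeAlgebra.ι ℝ a)))
    (ψ := 0) (fun m => ?_) q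
  rw [LinearMap.comp_apply, LinearMap.mulLeft_apply, ← monom_cons, wordCoeff_monom]
  simp

/-- Expanding the product of the factors `x_a + t h_a` gives each word that merges to `l` exactly
once, at the power of `t` that counts its letters `h`. -/
theorem wordCoeff_shift_monom {g : ℕ} (l : List (Fin g)) : ∀ (W : List (Fin g ⊕ Fin g)) (k : ℕ),
    wordCoeff W ((shift g (monom l)).coeff k) =
      if l = mergeWord W ∧ W.countP Sum.isRight = k then 1 else 0 := by
  induction l with
  | nil =>
    intro W k
    rw [monom_nil, map_one, coeff_one]
    cases W with
    | nil =>
      have h1 : wordCoeff ([] : List (Fin g ⊕ Fin g)) 1 = 1 := by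
        rw [← monom_nil, wordCoeff_monom, if_pos rfl]
      by_cases hk : k = 0
      · simp [hk, mergeWord, h1]
      · simp [hk, mergeWord, Ne.symm hk]
    | cons b W =>
      have h1 : wordCoeff (b :: W) 1 = 0 := by
        rw [← monom_nil, wordCoeff_monom]; simp
      by_cases hk : k = 0 <;> simp [hk, mergeWord, h1]
  | cons a l ih =>
    intro W k
    have hsh : shift g (monom (a :: l)) = C (xVar a) * shift g (monom l) +
        X * (C (hVar a) * shift g (monom l)) := shift_cons a l
    rw [hsh, coeff_add, coeff_C_mul, map_add, xVar]
    cases W with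
    | nil =>
      cases k with
      | zero => simp [wordCoeff_nil_ι_mul, mergeWord]
      | succ k => simp [coeff_X_mul, hVar, wordCoeff_nil_ι_mul, mergeWord]
    | cons b W =>
      rw [wordCoeff_cons_ι_mul, ih]
      have h2 : wordCoeff (b :: W) ((X * (C (hVar a) * shift g (monom l))).coeff k) =
          if 0 < k ∧ Sum.inr a = b ∧ l = mergeWord W ∧ W.countP Sum.isRight + 1 = k
            then 1 else 0 := by
        cases k with
        | zero => simp
        | succ k =>
          rw [coeff_X_mul, coeff_C_mul, hVar, wordCoeff_cons_ι_mul, ih]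
          by_cases h : Sum.inr a = b <;> simp [h]
      rw [h2]
      rcases b with b | b
      · by_cases h : a = b
        · rw [if_pos (congrArg Sum.inl h)]
          refine (congrArg₂ (· + ·) rfl (if_neg fun hh => Sum.inr_ne_inl hh.2.1)).trans ?_
          rw [add_zero]
          exact if_congr (by simp [h, mergeWord]) rfl rfl
        · simp [h, mergeWord]
      · by_cases h : a = b
        · simp [h, mergeWord]
          grind
        · simp [h, mergeWord]

theorem wordCoeff_hessian {g : ℕ} (p : NCPoly g) (W : List (Fin g ⊕ Fin g))
    (hW : W.countP Sum.isRight = 2) :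
    wordCoeff W (hessian p) = 2 * wordCoeff (mergeWord W) p := by
  rw [hessian_eq_coeff, map_smul, smul_eq_mul]
  congr 1
  let cf : NCPoly g →ₗ[ℝ] NCPolyXH g :=
    { toFun := fun q => (shift g q).coeff 2
      map_add' := fun q r => by rw [map_add, coeff_add]
      map_smul' := fun t q => by rw [map_smul, coeff_smul, RingHom.id_apply] }
  refine linearMap_ext_monom (φ := (wordCoeff W).comp cf) (ψ := wordCoeff (mergeWord W))
    (fun l => ?_) p
  rw [LinearMap.comp_apply, wordCoeff_monom]
  exact (wordCoeff_shift_monom l W 2).trans (by simp [hW])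

/-- The word of an entry of the border row. -/
def borderWord {g : ℕ} : ∀ j, KIdx g j → List (Fin g ⊕ Fin g)
  | 0 => fun b => [Sum.inr b]
  | j + 1 => fun b => Sum.inl b.1 :: borderWord j b.2

/-- The letters of an index of a Kronecker product. -/
def letters {g : ℕ} : ∀ j, KIdx g j → List (Fin g)
  | 0 => fun b => [b]
  | j + 1 => fun b => b.1 :: letters j b.2

theorem borderRow_eq_monom {g : ℕ} : ∀ (j : ℕ) (b : KIdx g j),
    borderRow g j b = monom (borderWord j b)
  | 0, b => by simp [borderRow, borderWord, monom, hVar]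
  | j + 1, b => by
    change xVar b.1 * borderRow g j b.2 = monom (Sum.inl b.1 :: borderWord j b.2)
    rw [monom_cons, borderRow_eq_monom j b.2, xVar]

theorem mergeWord_borderWord {g : ℕ} : ∀ (j : ℕ) (b : KIdx g j),
    mergeWord (borderWord j b) = letters j b
  | 0, b => by simp [mergeWord, borderWord, letters]
  | j + 1, b => by
    have := mergeWord_borderWord j b.2
    simp only [mergeWord] at this
    simp [mergeWord, borderWord, letters, this]

theorem countP_borderWord {g : ℕ} : ∀ (j : ℕ) (b : KIdx g j),
    (borderWord j b).countP Sum.isRight = 1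
  | 0, b => by simp [borderWord]
  | j + 1, b => by simp [borderWord, countP_borderWord j b.2]

theorem length_letters {g : ℕ} : ∀ (j : ℕ) (b : KIdx g j), (letters j b).length = j + 1
  | 0, b => by simp [letters]
  | j + 1, b => by simp [letters, length_letters j b.2]

theorem exists_letters_eq {g : ℕ} : ∀ (j : ℕ) (l : List (Fin g)), l.length = j + 1 →
    ∃ b : KIdx g j, letters j b = l
  | 0, l, h => by
    obtain ⟨a, rfl⟩ := List.length_eq_one_iff.1 h
    exact ⟨a, rfl⟩
  | j + 1, [], h => by simp at h
  | j + 1, a :: l, h => by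
    obtain ⟨b, hb⟩ := exists_letters_eq j l (by simpa using h)
    exact ⟨(a, b), by simp [letters, hb]⟩

/-- A border word ends at its only letter `h`, so the border words form a prefix code. -/
theorem borderWord_append_inj {g : ℕ} : ∀ (i j : ℕ) (a : KIdx g i) (b : KIdx g j)
    (s t : List (Fin g ⊕ Fin g)), borderWord i a ++ s = borderWord j b ++ t →
    (⟨i, a⟩ : Σ k, KIdx g k) = ⟨j, b⟩ ∧ s = t
  | 0, 0, a, b, s, t, h => by
    simp only [borderWord, List.cons_append, List.nil_append, List.cons.injEq, Sum.inr.injEq] at h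
    obtain ⟨rfl, rfl⟩ := h
    exact ⟨rfl, rfl⟩
  | 0, j + 1, a, b, s, t, h => by simp [borderWord] at h
  | i + 1, 0, a, b, s, t, h => by simp [borderWord] at h
  | i + 1, j + 1, (a, a'), (b, b'), s, t, h => by
    simp only [borderWord, List.cons_append, List.cons.injEq, Sum.inl.injEq] at h
    obtain ⟨rfl, h⟩ := h
    obtain ⟨h1, h2⟩ := borderWord_append_inj i j a' b' s t h
    obtain ⟨rfl, h1⟩ := Sigma.mk.inj_iff.1 h1
    cases h1
    exact ⟨rfl, h2⟩

theorem bIdx_ext {g d : ℕ} {a b : BIdx g d}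
    (h : (⟨a.1, a.2⟩ : Σ k, KIdx g k) = ⟨b.1, b.2⟩) : a = b := by
  obtain ⟨⟨i, hi⟩, a⟩ := a
  obtain ⟨⟨j, hj⟩, b⟩ := b
  obtain ⟨h1, h2⟩ := Sigma.mk.inj_iff.1 h
  cases h1
  cases h2
  rfl

theorem incl_monom {g : ℕ} (l : List (Fin g)) : incl g (monom l) = monom (l.map Sum.inl) := by
  induction l with
  | nil => simp [monom]
  | cons a l ih =>
    rw [monom_cons, map_mul, ih, List.map_cons, monom_cons, incl, FreeAlgebra.lift_ι_apply, xVar]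

/-- The coefficient in `V_aᵀ m V_b` of the word in which no letter separates the two `h`. -/
theorem wordCoeff_border_mul {g d : ℕ} (a b a₀ b₀ : BIdx g d) (m : NCPoly g) :
    wordCoeff (borderWord a₀.1 a₀.2 ++ (borderWord b₀.1 b₀.2).reverse)
      (borderT g d a * incl g m * star (borderT g d b)) =
    if a = a₀ ∧ b = b₀ then FreeAlgebra.lift ℝ (fun _ : Fin g => (0 : ℝ)) m else 0 := by
  let φ : NCPoly g →ₗ[ℝ] ℝ :=
    (wordCoeff (borderWord a₀.1 a₀.2 ++ (borderWord b₀.1 b₀.2).reverse)).comp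
    ((LinearMap.mulRight ℝ (star (borderT g d b))).comp
      ((LinearMap.mulLeft ℝ (borderT g d a)).comp (incl g).toLinearMap))
  let ψ : NCPoly g →ₗ[ℝ] ℝ :=
    if a = a₀ ∧ b = b₀ then (FreeAlgebra.lift ℝ (fun _ : Fin g => (0 : ℝ))).toLinearMap else 0
  refine (linearMap_ext_monom (φ := φ) (ψ := ψ) (fun l => ?_) m).trans ?_
  · simp only [φ, ψ, LinearMap.comp_apply, LinearMap.mulRight_apply, LinearMap.mulLeft_apply,
      AlgHom.toLinearMap_apply, incl_monom, borderT, borderRow_eq_monom, star_monom,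
      ← monom_append, wordCoeff_monom]
    have hl : FreeAlgebra.lift ℝ (fun _ : Fin g => (0 : ℝ)) (monom l) = if l = [] then 1 else 0 := by
      cases l with
      | nil => simp [monom]
      | cons c l => rw [monom_cons, map_mul, FreeAlgebra.lift_ι_apply]; simp
    have hiff : (borderWord a.1 a.2 ++ l.map Sum.inl ++ (borderWord b.1 b.2).reverse =
        borderWord a₀.1 a₀.2 ++ (borderWord b₀.1 b₀.2).reverse) ↔ (a = a₀ ∧ b = b₀) ∧ l = [] := by
      constructor
      · intro h
        rw [List.append_assoc] at h
        obtain ⟨h1, h2⟩ := borderWord_append_inj _ _ _ _ _ _ h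
        -- Once the left border word is cancelled, reversal turns the right one into a prefix.
        have h3 : borderWord b.1 b.2 ++ (l.map Sum.inl).reverse = borderWord b₀.1 b₀.2 ++ [] := by
          have := congrArg List.reverse h2
          simpa using this
        obtain ⟨h4, h5⟩ := borderWord_append_inj _ _ _ _ _ _ h3
        exact ⟨⟨bIdx_ext h1, bIdx_ext h4⟩, by simpa using h5⟩
      · rintro ⟨⟨rfl, rfl⟩, rfl⟩
        simp
    by_cases hab : a = a₀ ∧ b = b₀
    · simp only [hiff, hab, true_and]
      simpa using hl.symm
    · simp only [hiff, hab, false_and, if_false, LinearMap.zero_apply]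
  · simp only [ψ]
    split_ifs <;> rfl

/-- The entries of the scalar middle matrix are the coefficients of `p`, doubled. -/
theorem evalZero_apply {g : ℕ} {p : NCPoly g}
    {Z : Matrix (BIdx g (ncDegree p)) (BIdx g (ncDegree p)) (NCPoly g)}
    (hZ : IsMiddleMatrix p Z) (a b : BIdx g (ncDegree p)) :
    evalZero Z a b = 2 * wordCoeff (letters a.1 a.2 ++ (letters b.1 b.2).reverse) p := by
  have h1 := wordCoeff_hessian p (borderWord a.1 a.2 ++ (borderWord b.1 b.2).reverse)
    (by simp [countP_borderWord])
  have h2 : mergeWord (borderWord a.1 a.2 ++ (borderWord b.1 b.2).reverse) =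
      letters a.1 a.2 ++ (letters b.1 b.2).reverse := by
    rw [← mergeWord_borderWord, ← mergeWord_borderWord]
    simp [mergeWord]
  rw [← h2, ← h1, hZ]
  simp only [map_sum, wordCoeff_border_mul]
  rw [Finset.sum_eq_single a, Finset.sum_eq_single b]
  · simp [evalZero]
  · intro c _ hc; simp [hc]
  · simp
  · intro c _ hc; simp [hc]
  · simp

end Coefficients

/-! ### Blocks -/

section BlockVectors

variable {g d : ℕ}

/-- The vector that is `x` in the block with number `i` and zero in the other ones. -/
def embBlock (i : ℕ) (x : KIdx g i → ℝ) : BIdx g d → ℝ :=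
  fun a => if h : (a.1 : ℕ) = i then x (h ▸ a.2) else 0

/-- The block with number `i` of a vector; it is zero if there is no such block. -/
def compBlock (ξ : BIdx g d → ℝ) (i : ℕ) : KIdx g i → ℝ :=
  fun a => if h : i < d - 1 then ξ ⟨⟨i, h⟩, a⟩ else 0

theorem embBlock_apply_self {i : ℕ} (hi : i < d - 1) (x : KIdx g i → ℝ) (a : KIdx g i) :
    embBlock (d := d) i x ⟨⟨i, hi⟩, a⟩ = x a := by
  simp [embBlock]

theorem embBlock_apply_of_ne {i : ℕ} (x : KIdx g i → ℝ) {a : BIdx g d} (h : (a.1 : ℕ) ≠ i) :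
    embBlock i x a = 0 := by
  simp [embBlock, h]

theorem compBlock_embBlock_self {i : ℕ} (hi : i < d - 1) (x : KIdx g i → ℝ) :
    compBlock (embBlock (d := d) i x) i = x := by
  funext a
  simp only [compBlock, dif_pos hi, embBlock_apply_self]

theorem compBlock_embBlock_of_ne {i j : ℕ} (h : j ≠ i) (x : KIdx g i → ℝ) :
    compBlock (embBlock (d := d) i x) j = 0 := by
  funext a
  simp only [compBlock, Pi.zero_apply]
  split_ifs with hj
  · exact embBlock_apply_of_ne x h
  · rfl

theorem compBlock_add (ξ η : BIdx g d → ℝ) (i : ℕ) :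
    compBlock (ξ + η) i = compBlock ξ i + compBlock η i := by
  funext a
  simp only [compBlock, Pi.add_apply]
  split_ifs <;> simp

theorem compBlock_smul (t : ℝ) (ξ : BIdx g d → ℝ) (i : ℕ) :
    compBlock (t • ξ) i = t • compBlock ξ i := by
  funext a
  simp only [compBlock, Pi.smul_apply]
  split_ifs <;> simp

theorem embBlock_dotProduct (i : ℕ) (x : KIdx g i → ℝ) (ξ : BIdx g d → ℝ) :
    embBlock i x ⬝ᵥ ξ = x ⬝ᵥ compBlock ξ i := by
  simp only [dotProduct, Fintype.sum_sigma]
  by_cases hi : i < d - 1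
  · rw [Finset.sum_eq_single ⟨i, hi⟩]
    · refine Finset.sum_congr rfl fun a _ => ?_
      rw [embBlock_apply_self, compBlock, dif_pos hi]
    · intro j _ hj
      refine Finset.sum_eq_zero fun a _ => ?_
      rw [embBlock_apply_of_ne x (fun h => hj (Fin.ext h)), zero_mul]
    · simp
  · have h0 : compBlock ξ i = 0 := by funext a; simp [compBlock, hi]
    rw [h0]
    simp only [Pi.zero_apply, mul_zero, Finset.sum_const_zero]
    refine Finset.sum_eq_zero fun j _ => Finset.sum_eq_zero fun a _ => ?_
    rw [embBlock_apply_of_ne x (fun h => hi (h ▸ j.2)), zero_mul]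

variable (S : Matrix (BIdx g d) (BIdx g d) ℝ)

theorem compBlock_mulVec_embBlock (i j : ℕ) (y : KIdx g j → ℝ) :
    compBlock (S *ᵥ embBlock j y) i = block S i j *ᵥ y := by
  funext a
  by_cases hi : i < d - 1
  · rw [compBlock, dif_pos hi, mulVec, dotProduct_comm, embBlock_dotProduct, dotProduct_comm, mulVec]
    congr 1
    funext b
    simp [compBlock, block, hi]
  · simp [compBlock, block, hi, mulVec]

theorem embBlock_form (i j : ℕ) (x : KIdx g i → ℝ) (y : KIdx g j → ℝ) :
    embBlock i x ⬝ᵥ S *ᵥ embBlock j y = x ⬝ᵥ block S i j *ᵥ y := by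
  rw [embBlock_dotProduct, compBlock_mulVec_embBlock]

theorem eq_sum_embBlock (ξ : BIdx g d → ℝ) :
    ξ = ∑ i ∈ Finset.range (d - 1), embBlock i (compBlock ξ i) := by
  funext a
  obtain ⟨i, a⟩ := a
  rw [Finset.sum_apply, Finset.sum_eq_single (i : ℕ)]
  · rw [embBlock_apply_self i.2, compBlock, dif_pos i.2]
  · intro j _ hj
    exact embBlock_apply_of_ne _ (Ne.symm hj)
  · intro h
    exact absurd (Finset.mem_range.2 i.2) h

theorem block_eq_zero_of_le {i j : ℕ} (h : d - 1 ≤ i ∨ d - 1 ≤ j) : block S i j = 0 := by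
  funext a b
  simp only [block, Matrix.zero_apply]
  rw [dif_neg (by omega)]

/-- The range `n` may be smaller or larger than the number `d - 1` of blocks: both sums equal the
one up to the maximum, since the extra terms vanish. -/
theorem form_eq_sum_blocks {n : ℕ} (h : ∀ i j, n ≤ i + j → block S i j = 0)
    (ξ : BIdx g d → ℝ) :
    ξ ⬝ᵥ S *ᵥ ξ = ∑ i ∈ Finset.range n, ∑ j ∈ Finset.range n,
      compBlock ξ i ⬝ᵥ block S i j *ᵥ compBlock ξ j := by
  have h1 : ξ ⬝ᵥ S *ᵥ ξ = ∑ i ∈ Finset.range (d - 1), ∑ j ∈ Finset.range (d - 1),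
      compBlock ξ i ⬝ᵥ block S i j *ᵥ compBlock ξ j := by
    conv_lhs => rw [eq_sum_embBlock ξ]
    simp only [Matrix.mulVec_sum, sum_dotProduct, dotProduct_sum, embBlock_form]
    exact Finset.sum_comm
  have key : ∀ m, (∀ i j, m ≤ i ∨ m ≤ j → block S i j = 0) → ∀ k, m ≤ k →
      ∑ i ∈ Finset.range m, ∑ j ∈ Finset.range m,
        compBlock ξ i ⬝ᵥ block S i j *ᵥ compBlock ξ j =
      ∑ i ∈ Finset.range k, ∑ j ∈ Finset.range k,
        compBlock ξ i ⬝ᵥ block S i j *ᵥ compBlock ξ j := by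
    intro m hm k hk
    have hsub := Finset.range_subset_range.2 hk
    rw [← Finset.sum_subset hsub]
    · refine Finset.sum_congr rfl fun i _ => Finset.sum_subset hsub fun j _ hj => ?_
      rw [hm i j (Or.inr (by simpa using hj))]
      simp
    · intro i _ hi
      refine Finset.sum_eq_zero fun j _ => ?_
      rw [hm i j (Or.inl (by simpa using hi))]
      simp
  rw [h1, key (d - 1) (fun i j => block_eq_zero_of_le S) _ (le_max_left _ n),
    key n (fun i j hij => h i j (by omega)) _ (le_max_right (d - 1) n)]

end BlockVectors

/-! ### Linear algebra with a unit vector -/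

section UnitVector

variable {g : ℕ} {u : Fin g → ℝ}

theorem projPerp_mulVec (u x : Fin g → ℝ) : projPerp u *ᵥ x = x - (u ⬝ᵥ x) • u := by
  rw [projPerp, sub_mulVec, one_mulVec, vecMulVec_mulVec]
  simp

theorem projPerp_transpose (u : Fin g → ℝ) : (projPerp u)ᵀ = projPerp u := by
  rw [projPerp, transpose_sub, transpose_one, transpose_vecMulVec]

theorem dotProduct_projPerp_mulVec (hu : u ⬝ᵥ u = 1) (x : Fin g → ℝ) :
    u ⬝ᵥ projPerp u *ᵥ x = 0 := by
  rw [projPerp_mulVec, dotProduct_sub, dotProduct_smul, hu]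
  simp

theorem projPerp_mulVec_of_perp {x : Fin g → ℝ} (hx : u ⬝ᵥ x = 0) : projPerp u *ᵥ x = x := by
  rw [projPerp_mulVec, hx, zero_smul, sub_zero]

theorem form_projPerp (B : Matrix (Fin g) (Fin g) ℝ) (x : Fin g → ℝ) :
    x ⬝ᵥ (projPerp u * B * projPerp u) *ᵥ x =
      projPerp u *ᵥ x ⬝ᵥ B *ᵥ projPerp u *ᵥ x := by
  rw [← mulVec_mulVec, ← mulVec_mulVec, dotProduct_mulVec, ← mulVec_transpose, projPerp_transpose]

theorem projPerp_conj_posSemidef_iff (hu : u ⬝ᵥ u = 1) {B : Matrix (Fin g) (Fin g) ℝ}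
    (hB : Bᵀ = B) : (projPerp u * B * projPerp u).PosSemidef ↔
      ∀ x, u ⬝ᵥ x = 0 → 0 ≤ x ⬝ᵥ B *ᵥ x := by
  rw [posSemidef_iff_quadratic (by
    rw [transpose_mul, transpose_mul, projPerp_transpose, hB, Matrix.mul_assoc])]
  constructor
  · intro h x hx
    have := h x
    rwa [form_projPerp, projPerp_mulVec_of_perp hx] at this
  · intro h x
    rw [form_projPerp]
    exact h _ (dotProduct_projPerp_mulVec hu x)

theorem eq_smul_of_perp (hu : u ⬝ᵥ u = 1) {c : Fin g → ℝ}
    (h : ∀ x, u ⬝ᵥ x = 0 → x ⬝ᵥ c = 0) : c = (u ⬝ᵥ c) • u := by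
  have h1 : u ⬝ᵥ (c - (u ⬝ᵥ c) • u) = 0 := by
    rw [dotProduct_sub, dotProduct_smul, hu]; simp
  have h2 := h _ h1
  have h3 : (c - (u ⬝ᵥ c) • u) ⬝ᵥ (c - (u ⬝ᵥ c) • u) = 0 := by
    rw [dotProduct_sub, h2, dotProduct_smul, dotProduct_comm _ u, h1]; simp
  exact sub_eq_zero.1 (dotProduct_self_eq_zero.1 h3)

/-- A symmetric matrix whose compression to the complement of `u` vanishes. -/
theorem apply_of_compression_eq_zero (hu : u ⬝ᵥ u = 1) {M : Matrix (Fin g) (Fin g) ℝ}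
    (hM : Mᵀ = M) (h : ∀ x y, u ⬝ᵥ x = 0 → u ⬝ᵥ y = 0 → x ⬝ᵥ M *ᵥ y = 0) (i j : Fin g) :
    M i j = u j * (M *ᵥ u) i + u i * (M *ᵥ u) j - u i * u j * (u ⬝ᵥ M *ᵥ u) := by
  -- With `y = P e_j`, the hypothesis makes `M P e_j` a multiple of `u`; its entry number `i` gives
  -- the formula.
  have hy := dotProduct_projPerp_mulVec hu (Pi.single j 1)
  have h1 := congrFun (eq_smul_of_perp hu (fun x hx => h x _ hx hy)) i
  have h2 : projPerp u *ᵥ Pi.single j 1 = Pi.single j 1 - u j • u := by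
    rw [projPerp_mulVec]; simp
  have h3 : u ⬝ᵥ M *ᵥ Pi.single j 1 = (M *ᵥ u) j := by
    rw [dotProduct_mulVec_comm_of_symm hM]; simp
  rw [h2, mulVec_sub, mulVec_smul, dotProduct_sub, dotProduct_smul, h3] at h1
  simp at h1
  linarith

theorem kronOne_transpose_mulVec (u : Fin g → ℝ) (z : Fin g × Fin g → ℝ) (j : Fin g) :
    ((kronOne u)ᵀ *ᵥ z) j = ∑ i, u i * z (i, j) := by
  simp only [mulVec, dotProduct, transpose_apply, kronOne, of_apply, Fintype.sum_prod_type,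
    Matrix.one_apply]
  simp

theorem kronOne_conj_apply (u : Fin g → ℝ) (A : Matrix (Fin g) (Fin g) ℝ)
    (k l : Fin g × Fin g) :
    (kronOne u * A * (kronOne u)ᵀ) k l = u k.1 * u l.1 * A k.2 l.2 := by
  simp only [mul_apply, transpose_apply, kronOne, of_apply, Matrix.one_apply]
  simp
  ring

theorem kronOne_mul_transpose_mul_apply (u : Fin g → ℝ)
    (B : Matrix (Fin g × Fin g) (Fin g × Fin g) ℝ) (k l : Fin g × Fin g) :
    (kronOne u * ((kronOne u)ᵀ * B)) k l = u k.1 * ∑ i, u i * B (i, k.2) l := by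
  simp only [mul_apply, transpose_apply, kronOne, of_apply, Matrix.one_apply,
    Fintype.sum_prod_type]
  simp

/-- A symmetric matrix whose range lies in the range of `u ⊗ I`. -/
theorem eq_kronOne_conj {B : Matrix (Fin g × Fin g) (Fin g × Fin g) ℝ} (hB : Bᵀ = B)
    (h : ∀ k l, B k l = u k.1 * ∑ i, u i * B (i, k.2) l) :
    B = kronOne u * ((kronOne u)ᵀ * B * kronOne u) * (kronOne u)ᵀ := by
  -- The hypothesis says that `(u ⊗ I)(u ⊗ I)ᵀ` fixes `B` from the left; by symmetry of `B` it also
  -- does so from the right.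
  have h1 : kronOne u * ((kronOne u)ᵀ * B) = B := by
    ext k l
    rw [kronOne_mul_transpose_mul_apply, ← h]
  have h2 : B * kronOne u * (kronOne u)ᵀ = B := by
    have := congrArg Matrix.transpose h1
    rwa [transpose_mul, transpose_mul, transpose_transpose, hB] at this
  calc B = kronOne u * ((kronOne u)ᵀ * B) := h1.symm
    _ = kronOne u * ((kronOne u)ᵀ * (B * kronOne u * (kronOne u)ᵀ)) := by rw [h2]
    _ = _ := by simp only [Matrix.mul_assoc]

theorem kronOne_transpose_mulVec_kron (hu : u ⬝ᵥ u = 1) (ζ : Fin g → ℝ) :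
    (kronOne u)ᵀ *ᵥ kronVec u ζ = ζ := by
  funext j
  rw [kronOne_transpose_mulVec]
  simp only [kronVec, ← mul_assoc]
  rw [← Finset.sum_mul]
  have : ∑ i, u i * u i = 1 := hu
  rw [this, one_mul]

theorem form_kronOne_conj (A : Matrix (Fin g) (Fin g) ℝ) (z : Fin g × Fin g → ℝ) :
    z ⬝ᵥ (kronOne u * A * (kronOne u)ᵀ) *ᵥ z =
      (kronOne u)ᵀ *ᵥ z ⬝ᵥ A *ᵥ (kronOne u)ᵀ *ᵥ z := by
  rw [← mulVec_mulVec, ← mulVec_mulVec, dotProduct_mulVec, ← mulVec_transpose]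

theorem structT_vecMulVec (u : Fin g → ℝ) (v : Fin g × Fin g → ℝ) :
    structT (vecMulVec u v) = (matG v)ᵀ * (kronOne u)ᵀ := by
  ext i k
  simp only [structT, of_apply, vecMulVec_apply, mul_apply, transpose_apply, matG, kronOne,
    Matrix.one_apply]
  simp
  ring

/-- The two terms with range spanned by `u` die against `x`. Only the structured transpose survives,
and it sees `z` through `(u ⊗ I)ᵀ z` alone. -/
theorem form_block01 {x : Fin g → ℝ} (hx : u ⬝ᵥ x = 0) (y : Fin g → ℝ) (v z : Fin g × Fin g → ℝ) :
    x ⬝ᵥ (vecMulVec u (kronVec u y) + vecMulVec u v + structT (vecMulVec u v)) *ᵥ z =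
      (kronOne u)ᵀ *ᵥ z ⬝ᵥ matG v *ᵥ x := by
  rw [add_mulVec, add_mulVec, dotProduct_add, dotProduct_add, vecMulVec_mulVec, vecMulVec_mulVec]
  have h0 : x ⬝ᵥ u = 0 := by rw [dotProduct_comm, hx]
  simp only [dotProduct_smul, h0, smul_zero, zero_add]
  rw [structT_vecMulVec, ← mulVec_mulVec, dotProduct_mulVec, ← mulVec_transpose,
    transpose_transpose, dotProduct_comm]

end UnitVector

/-! ### Matrices whose entries depend on the concatenated index words -/

/-- The entry of `S` at `(a, b)` is `T` of the word `a` followed by the reverse of the word `b`,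
for a palindromic function `T` on words whose support has maximal length `d`. -/
structure IsWordMatrix {g d : ℕ} (T : List (Fin g) → ℝ) (S : Matrix (BIdx g d) (BIdx g d) ℝ) :
    Prop where
  apply : ∀ a b, S a b = T (letters a.1 a.2 ++ (letters b.1 b.2).reverse)
  reverse : ∀ l, T l.reverse = T l
  eq_zero : ∀ l, d < l.length → T l = 0
  exists_ne : 0 < d → ∃ l, l.length = d ∧ T l ≠ 0

theorem isWordMatrix_evalZero {g : ℕ} {p : NCPoly g} (hp : star p = p)
    {Z : Matrix (BIdx g (ncDegree p)) (BIdx g (ncDegree p)) (NCPoly g)}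
    (hZ : IsMiddleMatrix p Z) : IsWordMatrix (fun l => 2 * wordCoeff l p) (evalZero Z) where
  apply := evalZero_apply hZ
  reverse l := by rw [← wordCoeff_star, hp]
  eq_zero l hl := by rw [wordCoeff_eq_zero_of_ncDegree_lt hl, mul_zero]
  exists_ne h := by
    obtain ⟨l, hl, hne⟩ := exists_wordCoeff_ne_zero h
    exact ⟨l, hl, mul_ne_zero two_ne_zero hne⟩

namespace IsWordMatrix

variable {g d : ℕ} {T : List (Fin g) → ℝ} {S : Matrix (BIdx g d) (BIdx g d) ℝ}

theorem symm (h : IsWordMatrix T S) : Sᵀ = S := by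
  ext a b
  rw [transpose_apply, h.apply, h.apply, ← h.reverse]
  simp

/-- No bound on `i, j` is needed: outside the matrix the word has more than `d` letters, and both
sides are zero. -/
theorem block_apply (h : IsWordMatrix T S) (i j : ℕ) (a : KIdx g i) (b : KIdx g j) :
    block S i j a b = T (letters i a ++ (letters j b).reverse) := by
  unfold block
  split_ifs with hij
  · exact h.apply _ _
  · rw [h.eq_zero]
    simp only [List.length_append, List.length_reverse, length_letters]
    omega

theorem block_eq_zero (h : IsWordMatrix T S) {i j : ℕ} (hij : d < i + j + 2) :
    block S i j = 0 := by
  ext a b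
  rw [h.block_apply, h.eq_zero, Matrix.zero_apply]
  simp only [List.length_append, List.length_reverse, length_letters]
  omega

/-- A word of maximal length in the support can be cut after any number `i + 1` of letters. -/
theorem exists_block_apply_ne_zero (h : IsWordMatrix T S) {i j : ℕ} (hij : i + j + 2 = d) :
    ∃ (a : KIdx g i) (b : KIdx g j), block S i j a b ≠ 0 := by
  obtain ⟨l, hl, hne⟩ := h.exists_ne (by omega)
  obtain ⟨a, ha⟩ := exists_letters_eq i (l.take (i + 1)) (by rw [List.length_take]; omega)
  obtain ⟨b, hb⟩ := exists_letters_eq j (l.drop (i + 1)).reverse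
    (by rw [List.length_reverse, List.length_drop]; omega)
  refine ⟨a, b, ?_⟩
  rwa [h.block_apply, ha, hb, List.reverse_reverse, List.take_append_drop]

theorem block_transpose (h : IsWordMatrix T S) (i j : ℕ) : (block S i j)ᵀ = block S j i := by
  ext a b
  rw [transpose_apply, h.block_apply, h.block_apply, ← h.reverse]
  simp

theorem block00_transpose (h : IsWordMatrix T S) : (block00 S)ᵀ = block00 S :=
  h.block_transpose 0 0

theorem muMinus_eq_zero_iff (h : IsWordMatrix T S) : muMinus S = 0 ↔
    (∀ i j, 1 ≤ i + j → block S i j = 0) ∧ (block00 S).PosSemidef := by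
  rw [NCHessian.muMinus_eq_zero_iff h.symm, posSemidef_iff_quadratic h.symm,
    posSemidef_iff_quadratic h.block00_transpose]
  constructor
  · intro hpos
    refine ⟨fun i j hij => ?_, fun x => ?_⟩
    · by_cases hd : d < i + j + 2
      · exact h.block_eq_zero hd
      -- Now `d ≥ 3`, so `𝒵_{d-2,d-2} = 0`. Its null vectors lie in the kernel, which contradicts
      -- `𝒵_{0,d-2} ≠ 0`.
      exfalso
      obtain ⟨a, b, hne⟩ := h.exists_block_apply_ne_zero (i := 0) (j := d - 2) (by omega)
      have h0 := dotProduct_mulVec_eq_zero_of_null h.symm (W := ⊤) (fun x _ => hpos x)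
        (f := embBlock (d - 2) (Pi.single b 1)) (x := embBlock 0 (Pi.single a 1))
        Submodule.mem_top Submodule.mem_top
        (by rw [embBlock_form, h.block_eq_zero (by omega)]; simp)
      rw [embBlock_form] at h0
      apply hne
      simpa using h0
    · have := hpos (embBlock 0 x)
      rwa [embBlock_form] at this
  · rintro ⟨hz, hpos⟩ ξ
    rw [form_eq_sum_blocks S (n := 1) hz]
    rw [Finset.sum_range_one, Finset.sum_range_one]
    exact hpos (compBlock ξ 0)

theorem muMinus_eq_one_iff_of_two (h : IsWordMatrix T S) (hd : d = 2) : muMinus S = 1 ↔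
    (∀ i j, 1 ≤ i + j → block S i j = 0) ∧
      ∃ u : Fin g → ℝ, u ⬝ᵥ u = 1 ∧ (∃ lam : ℝ, lam < 0 ∧ block00 S *ᵥ u = lam • u) ∧
        (projPerp u * block00 S * projPerp u).PosSemidef := by
  subst hd
  have hbij : Function.Bijective (fun b : Fin g => (⟨⟨0, by norm_num⟩, b⟩ : BIdx g 2)) := by
    constructor
    · intro a b hab
      simpa using hab
    · rintro ⟨⟨i, hi⟩, b⟩
      obtain rfl : i = 0 := by omega
      exact ⟨b, rfl⟩
  have hre : Matrix.reindex (Equiv.ofBijective _ hbij).symm (Equiv.ofBijective _ hbij).symm S =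
      block00 S := by
    ext a b
    rfl
  rw [← muMinus_reindex (Equiv.ofBijective _ hbij).symm, hre,
    NCHessian.muMinus_eq_one_iff h.block00_transpose,
    and_iff_right (fun i j hij => h.block_eq_zero (by omega))]
  refine exists_congr fun u => and_congr_right fun hu => and_congr_right fun _ => ?_
  rw [projPerp_conj_posSemidef_iff hu h.block00_transpose]

/-- With one negative eigenvalue, the form is nonnegative on the vectors whose leading block is
orthogonal to a suitable unit vector. -/
theorem exists_unit_of_muMinus_eq_one (h : IsWordMatrix T S) (hd : 3 ≤ d) (h1 : muMinus S = 1) :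
    ∃ u : Fin g → ℝ, u ⬝ᵥ u = 1 ∧
      ∀ ξ : BIdx g d → ℝ, u ⬝ᵥ compBlock ξ 0 = 0 → 0 ≤ ξ ⬝ᵥ S *ᵥ ξ := by
  obtain ⟨a, b, hne⟩ := h.exists_block_apply_ne_zero (i := 0) (j := d - 2) (by omega)
  let c : Fin g → ℝ := fun a => block S 0 (d - 2) a b
  let f : BIdx g d → ℝ := embBlock (d - 2) (Pi.single b 1)
  have hc : 0 < c ⬝ᵥ c := by
    refine lt_of_le_of_ne (Finset.sum_nonneg fun i _ => mul_self_nonneg _) fun h0 => hne ?_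
    exact congrFun (dotProduct_self_eq_zero.1 h0.symm) a
  -- Pairing with `f` sees only the leading block, because `𝒵_{i,d-2} = 0` for `i ≥ 1`; in
  -- particular `f` is isotropic.
  have hf : ∀ ξ : BIdx g d → ℝ, ξ ⬝ᵥ S *ᵥ f = compBlock ξ 0 ⬝ᵥ c := by
    intro ξ
    conv_lhs => rw [eq_sum_embBlock ξ]
    rw [sum_dotProduct, Finset.sum_eq_single 0]
    · rw [embBlock_form, mulVec_single_one]
      rfl
    · intro i _ hi
      rw [embBlock_form, h.block_eq_zero (by omega), zero_mulVec, dotProduct_zero]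
    · intro h0
      exact absurd (Finset.mem_range.2 (by omega)) h0
  refine ⟨(√(c ⬝ᵥ c))⁻¹ • c, ?_, fun ξ hξ => ?_⟩
  · rw [smul_dotProduct, dotProduct_smul, smul_eq_mul, smul_eq_mul, ← mul_assoc, ← mul_inv,
      Real.mul_self_sqrt hc.le, inv_mul_cancel₀ hc.ne']
  · refine nonneg_of_orthogonal_isotropic h.symm h1 (f := f) (e := embBlock 0 c) ?_ ?_ ?_
    · rw [hf, compBlock_embBlock_of_ne (by omega)]
      simp
    · rw [hf, compBlock_embBlock_self (by omega)]
      exact hc.ne'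
    · rw [smul_dotProduct, smul_eq_mul, mul_eq_zero] at hξ
      rw [hf]
      refine (dotProduct_comm _ _).trans (hξ.resolve_left ?_)
      exact inv_ne_zero (Real.sqrt_ne_zero'.2 hc)

/-- Null vectors of the blocks beyond the leading one lie in the kernel of the restricted form. -/
theorem form_eq_zero_of_null (h : IsWordMatrix T S) {u : Fin g → ℝ}
    (hpos : ∀ ξ : BIdx g d → ℝ, u ⬝ᵥ compBlock ξ 0 = 0 → 0 ≤ ξ ⬝ᵥ S *ᵥ ξ)
    {i : ℕ} (hi : 1 ≤ i) {z : KIdx g i → ℝ} (hz : z ⬝ᵥ block S i i *ᵥ z = 0)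
    {ξ : BIdx g d → ℝ} (hξ : u ⬝ᵥ compBlock ξ 0 = 0) : ξ ⬝ᵥ S *ᵥ embBlock i z = 0 := by
  let W : Submodule ℝ (BIdx g d → ℝ) :=
    { carrier := {η | u ⬝ᵥ compBlock η 0 = 0}
      add_mem' := fun {η θ} hη hθ => by
        simp only [Set.mem_ofPred_eq] at *
        rw [compBlock_add]
        exact (dotProduct_add _ _ _).trans (by rw [hη, hθ, add_zero])
      zero_mem' := by
        have h0 : compBlock (0 : BIdx g d → ℝ) 0 = 0 := by
          funext a
          simp [compBlock]
        change u ⬝ᵥ compBlock _ 0 = 0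
        rw [h0]
        exact dotProduct_zero u
      smul_mem' := fun t η hη => by
        simp only [Set.mem_ofPred_eq] at *
        rw [compBlock_smul]
        exact (dotProduct_smul _ _ _).trans (by rw [hη, smul_zero]) }
  refine dotProduct_mulVec_eq_zero_of_null h.symm (W := W) hpos ?_ hξ (by rwa [embBlock_form])
  change u ⬝ᵥ compBlock _ 0 = 0
  rw [compBlock_embBlock_of_ne (by omega)]
  exact dotProduct_zero u

/-- The leading row of blocks at null vectors. -/
theorem block_zero_eq_zero_of_null (h : IsWordMatrix T S) {u : Fin g → ℝ} (hd : 2 ≤ d)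
    (hpos : ∀ ξ : BIdx g d → ℝ, u ⬝ᵥ compBlock ξ 0 = 0 → 0 ≤ ξ ⬝ᵥ S *ᵥ ξ)
    {i : ℕ} (hi : 1 ≤ i) {z : KIdx g i → ℝ} (hz : z ⬝ᵥ block S i i *ᵥ z = 0)
    {x : Fin g → ℝ} (hx : u ⬝ᵥ x = 0) : x ⬝ᵥ (block S 0 i *ᵥ z : Fin g → ℝ) = 0 := by
  have := h.form_eq_zero_of_null hpos hi hz (ξ := embBlock 0 x)
    (by rw [compBlock_embBlock_self (by omega)]; exact hx)
  rwa [embBlock_form] at this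

/-- If `d ≥ 5`, then `𝒵_{d-3,d-3} = 0`. Vectors in block `1` have zero leading block and so lie in
the hyperplane, which forces `𝒵_{1,d-3} = 0`; but its words have length exactly `d`. -/
theorem le_four (h : IsWordMatrix T S) {u : Fin g → ℝ}
    (hpos : ∀ ξ : BIdx g d → ℝ, u ⬝ᵥ compBlock ξ 0 = 0 → 0 ≤ ξ ⬝ᵥ S *ᵥ ξ) : d ≤ 4 := by
  by_contra! hd
  obtain ⟨a, b, hne⟩ := h.exists_block_apply_ne_zero (i := 1) (j := d - 3) (by omega)
  have h0 := h.form_eq_zero_of_null hpos (i := d - 3) (by omega) (z := Pi.single b 1)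
    (by rw [h.block_eq_zero (by omega), zero_mulVec, dotProduct_zero])
    (ξ := embBlock 1 (Pi.single a 1))
    (by rw [compBlock_embBlock_of_ne (by omega)]; exact dotProduct_zero u)
  rw [embBlock_form] at h0
  apply hne
  simpa using h0

/-- For words of length four, `T` splits off the vector `u` at the first letter. -/
theorem apply_cons_of_length (h : IsWordMatrix T S) {u : Fin g → ℝ}
    (hu : u ⬝ᵥ u = 1)
    (hpos : ∀ ξ : BIdx g d → ℝ, u ⬝ᵥ compBlock ξ 0 = 0 → 0 ≤ ξ ⬝ᵥ S *ᵥ ξ)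
    (a : Fin g) {l : List (Fin g)} (hl : l.length = 3) :
    T (a :: l) = u a * ∑ i, u i * T (i :: l) := by
  rcases (h.le_four hpos).lt_or_eq with hd4 | hd4
  · have h0 : ∀ i, T (i :: l) = 0 := fun i => h.eq_zero _ (by simp [hl, hd4])
    simp [h0]
  · obtain ⟨b, hb⟩ := exists_letters_eq 2 l.reverse (by simp [hl])
    have hT : ∀ i, (block S 0 2 *ᵥ Pi.single b 1) i = T (i :: l) := by
      intro i
      rw [mulVec_single_one]
      exact (h.block_apply 0 2 i b).trans (by rw [hb]; simp [letters])
    -- Since `𝒵₂₂ = 0` for `d = 4`, every vector of block `2` is null, so the columns of `𝒵₀₂` are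
    -- multiples of `u`.
    have := congrFun (eq_smul_of_perp hu (c := block S 0 2 *ᵥ Pi.single b 1) fun x hx =>
      h.block_zero_eq_zero_of_null (by omega) hpos (i := 2) (by omega)
        (by rw [h.block_eq_zero (by omega), zero_mulVec, dotProduct_zero]) hx) a
    rw [hT, Pi.smul_apply, smul_eq_mul, mul_comm] at this
    rw [this]
    simp only [dotProduct, hT]

/-- The column index is read backwards, so its second component is the middle letter. -/
theorem block01_apply (h : IsWordMatrix T S) (a : Fin g) (k : Fin g × Fin g) :
    block01 S a k = T [a, k.2, k.1] := h.block_apply 0 1 a k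

theorem block11_apply (h : IsWordMatrix T S) (k l : Fin g × Fin g) :
    block11 S k l = T [k.1, k.2, l.2, l.1] := h.block_apply 1 1 k l

theorem block02_apply (h : IsWordMatrix T S) (a : Fin g) (k : Fin g × Fin g × Fin g) :
    block02 S a k = T [a, k.2.2, k.2.1, k.1] := h.block_apply 0 2 a k

theorem block11_eq (h : IsWordMatrix T S) {u : Fin g → ℝ} (hu : u ⬝ᵥ u = 1)
    (hpos : ∀ ξ : BIdx g d → ℝ, u ⬝ᵥ compBlock ξ 0 = 0 → 0 ≤ ξ ⬝ᵥ S *ᵥ ξ) :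
    block11 S = kronOne u * ((kronOne u)ᵀ * block11 S * kronOne u) * (kronOne u)ᵀ := by
  refine eq_kronOne_conj (h.block_transpose 1 1) fun k l => ?_
  simp only [h.block11_apply]
  exact h.apply_cons_of_length hu hpos _ rfl

/-- The coefficients of the words of length three with a given middle letter form a matrix whose
compression to the complement of `u` vanishes. -/
theorem compression_block01 (h : IsWordMatrix T S) (hd : 2 ≤ d) {u : Fin g → ℝ} (hu : u ⬝ᵥ u = 1)
    (hpos : ∀ ξ : BIdx g d → ℝ, u ⬝ᵥ compBlock ξ 0 = 0 → 0 ≤ ξ ⬝ᵥ S *ᵥ ξ) (b : Fin g)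
    {x y : Fin g → ℝ} (hx : u ⬝ᵥ x = 0) (hy : u ⬝ᵥ y = 0) :
    x ⬝ᵥ (Matrix.of fun i j => T [i, b, j]) *ᵥ y = 0 := by
  -- The vector `y ⊗ e_b` is killed by `(u ⊗ I)ᵀ`, hence null for `𝒵₁₁`; pairing it with `x` through
  -- `𝒵₀₁` gives the claim.
  let z : Fin g × Fin g → ℝ := fun k => y k.1 * (if k.2 = b then 1 else 0)
  have hz : (kronOne u)ᵀ *ᵥ z = 0 := by
    funext j
    rw [kronOne_transpose_mulVec]
    simp only [z, ← mul_assoc]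
    have : ∑ i, u i * y i = 0 := hy
    simp [this]
  have hz1 : z ⬝ᵥ block11 S *ᵥ z = 0 := by
    rw [h.block11_eq hu hpos, form_kronOne_conj, hz, zero_dotProduct]
  have h0 : x ⬝ᵥ block01 S *ᵥ z = 0 :=
    h.block_zero_eq_zero_of_null hd hpos (i := 1) le_rfl (z := z) hz1 hx
  rw [← h0]
  congr 1
  funext i
  simp only [mulVec, dotProduct, of_apply, h.block01_apply, Fintype.sum_prod_type, z]
  simp

end IsWordMatrix

/-! ### The matrix `E₁` -/

section E1

variable {g d : ℕ} {S : Matrix (BIdx g d) (BIdx g d) ℝ} {u y : Fin g → ℝ}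
  {v : Fin g × Fin g → ℝ} {A : Matrix (Fin g) (Fin g) ℝ}

theorem matE1_transpose (hS : (block00 S)ᵀ = block00 S) (hA : Aᵀ = A) :
    (matE1 S u v A)ᵀ = matE1 S u v A := by
  rw [matE1, fromBlocks_transpose, transpose_transpose, hA, transpose_mul, transpose_mul,
    projPerp_transpose, hS, Matrix.mul_assoc]

theorem matE1_form (η ζ : Fin g → ℝ) :
    Sum.elim η ζ ⬝ᵥ matE1 S u v A *ᵥ Sum.elim η ζ =
      projPerp u *ᵥ η ⬝ᵥ block00 S *ᵥ projPerp u *ᵥ η + 2 * (ζ ⬝ᵥ matG v *ᵥ η) +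
        ζ ⬝ᵥ A *ᵥ ζ := by
  rw [matE1, fromBlocks_mulVec, sumElim_dotProduct_sumElim]
  simp only [Sum.elim_comp_inl, Sum.elim_comp_inr, dotProduct_add, form_projPerp]
  rw [dotProduct_mulVec η (matG v)ᵀ, vecMul_transpose, dotProduct_comm _ ζ]
  ring

/-- On vectors whose leading block is orthogonal to `u`, the form of `S` is that of `E₁`. -/
theorem matE1_form_of_perp (h01 : block01 S = vecMulVec u (kronVec u y) + vecMulVec u v +
      structT (vecMulVec u v)) (h11 : block11 S = kronOne u * A * (kronOne u)ᵀ)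
    {x : Fin g → ℝ} (hx : u ⬝ᵥ x = 0) (z : Fin g × Fin g → ℝ) :
    Sum.elim x ((kronOne u)ᵀ *ᵥ z) ⬝ᵥ matE1 S u v A *ᵥ Sum.elim x ((kronOne u)ᵀ *ᵥ z) =
      x ⬝ᵥ block00 S *ᵥ x + 2 * (x ⬝ᵥ block01 S *ᵥ z) + z ⬝ᵥ block11 S *ᵥ z := by
  rw [matE1_form, projPerp_mulVec_of_perp hx, h01, form_block01 hx, h11, form_kronOne_conj]

/-- Positivity of `E₁` thus needs testing only on first components orthogonal to `u`, where
`matE1_form_of_perp` applies. -/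
theorem matE1_form_projPerp (hu : u ⬝ᵥ u = 1) (hv : matG v *ᵥ u = 0) (η ζ : Fin g → ℝ) :
    Sum.elim (projPerp u *ᵥ η) ζ ⬝ᵥ matE1 S u v A *ᵥ Sum.elim (projPerp u *ᵥ η) ζ =
      Sum.elim η ζ ⬝ᵥ matE1 S u v A *ᵥ Sum.elim η ζ := by
  rw [matE1_form, matE1_form, projPerp_mulVec_of_perp (dotProduct_projPerp_mulVec hu η)]
  have : matG v *ᵥ projPerp u *ᵥ η = matG v *ᵥ η := by
    rw [projPerp_mulVec, mulVec_sub, mulVec_smul, hv, smul_zero, sub_zero]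
  rw [this]

end E1

/-! ### The characterization in degree at least three -/

namespace IsWordMatrix

variable {g d : ℕ} {T : List (Fin g) → ℝ} {S : Matrix (BIdx g d) (BIdx g d) ℝ}

theorem exists_hasForm (h : IsWordMatrix T S) (hd : 3 ≤ d) (h1 : muMinus S = 1) :
    ∃ (u y : Fin g → ℝ) (v : Fin g × Fin g → ℝ) (A : Matrix (Fin g) (Fin g) ℝ),
      HasForm S u y v A := by
  obtain ⟨u, hu, hpos⟩ := h.exists_unit_of_muMinus_eq_one hd h1
  let M : Fin g → Matrix (Fin g) (Fin g) ℝ := fun b => Matrix.of fun i j => T [i, b, j]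
  have hM : ∀ b, (M b)ᵀ = M b := by
    intro b
    ext i j
    exact h.reverse [i, b, j]
  let y : Fin g → ℝ := fun b => u ⬝ᵥ M b *ᵥ u
  -- For each middle letter `b`, `M b u` is split into its `u`-component `y b` and a part orthogonal
  -- to `u`, which is row `b` of `mat_g v`.
  let v : Fin g × Fin g → ℝ := fun k => (M k.2 *ᵥ u) k.1 - y k.2 * u k.1
  let A : Matrix (Fin g) (Fin g) ℝ := (kronOne u)ᵀ * block11 S * kronOne u
  have h11 : block11 S = kronOne u * A * (kronOne u)ᵀ := h.block11_eq hu hpos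
  have h11' : ∀ a i j b, T [a, i, j, b] = u a * u b * A i j := by
    intro a i j b
    have := congrFun (congrFun h11 (a, i)) (b, j)
    rwa [h.block11_apply, kronOne_conj_apply] at this
  have h01 : block01 S = vecMulVec u (kronVec u y) + vecMulVec u v +
      structT (vecMulVec u v) := by
    ext a k
    rw [h.block01_apply]
    refine (apply_of_compression_eq_zero hu (hM k.2)
      (fun x x' hx hx' => h.compression_block01 (by omega) hu hpos k.2 hx hx') a k.1).trans ?_
    simp only [Matrix.add_apply, vecMulVec_apply, structT, of_apply, kronVec, v, y]
    ring
  have hv : matG v *ᵥ u = 0 := by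
    funext b
    have : (matG v *ᵥ u) b = u ⬝ᵥ M b *ᵥ u - y b * (u ⬝ᵥ u) := by
      simp only [mulVec, dotProduct, matG, of_apply, v, sub_mul, Finset.sum_sub_distrib,
        Finset.mul_sum]
      congr 1
      · exact Finset.sum_congr rfl fun i _ => by rw [mul_comm, Finset.mul_sum]
      · exact Finset.sum_congr rfl fun i _ => by ring
    rw [this, hu, mul_one, Pi.zero_apply]
    exact sub_self _
  have hA : Aᵀ = A := by
    have hB : (block11 S)ᵀ = block11 S := h.block_transpose 1 1
    simp only [A]
    rw [transpose_mul, transpose_mul, hB, transpose_transpose, Matrix.mul_assoc]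
  refine ⟨u, y, v, A, ?_, h01, ?_, (h.block_transpose 0 1).symm, h11, ?_,
    (h.block_transpose 0 2).symm, hu, hv, hA, rfl, ?_⟩
  · intro i j hij
    have := h.le_four hpos
    exact h.block_eq_zero (by omega)
  · ext a k
    simp only [structT, of_apply, h.block01_apply]
    exact h.reverse [a, k.2, k.1]
  · ext a k
    rw [h.block02_apply, h11', vecMulVec_apply, kronVec₃, Matrix.vec]
    ring
  · rw [posSemidef_iff_quadratic (matE1_transpose h.block00_transpose hA)]
    intro w
    obtain ⟨η, ζ, rfl⟩ : ∃ η ζ, w = Sum.elim η ζ := ⟨_, _, (Sum.elim_comp_inl_inr w).symm⟩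
    have hη := dotProduct_projPerp_mulVec hu η
    -- Writing `ζ = (u ⊗ I)ᵀ(u ⊗ ζ)` turns the form of `E₁` into that of `S` at the vector with
    -- blocks `Pη` and `u ⊗ ζ`, which lies in the hyperplane.
    rw [← matE1_form_projPerp hu hv, ← kronOne_transpose_mulVec_kron hu ζ,
      matE1_form_of_perp h01 h11 hη]
    have h0 := hpos (embBlock 0 (projPerp u *ᵥ η) + embBlock 1 (kronVec u ζ)) (by
      rw [compBlock_add, compBlock_embBlock_self (by omega), compBlock_embBlock_of_ne (by omega),
        add_zero]
      exact hη)
    rw [mulVec_add, add_dotProduct, dotProduct_add, dotProduct_add,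
      dotProduct_mulVec_comm_of_symm h.symm (embBlock 1 _), embBlock_form, embBlock_form,
      embBlock_form] at h0
    change 0 ≤ projPerp u *ᵥ η ⬝ᵥ block00 S *ᵥ projPerp u *ᵥ η +
      projPerp u *ᵥ η ⬝ᵥ block01 S *ᵥ kronVec u ζ + (projPerp u *ᵥ η ⬝ᵥ block01 S *ᵥ kronVec u ζ +
        kronVec u ζ ⬝ᵥ block11 S *ᵥ kronVec u ζ) at h0
    linarith

theorem muMinus_eq_one_of_hasForm (h : IsWordMatrix T S) (hd : 3 ≤ d) {u y : Fin g → ℝ}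
    {v : Fin g × Fin g → ℝ} {A : Matrix (Fin g) (Fin g) ℝ} (hF : HasForm S u y v A) :
    muMinus S = 1 := by
  have hne : muMinus S ≠ 0 := by
    rw [Ne, h.muMinus_eq_zero_iff]
    rintro ⟨h0, -⟩
    obtain ⟨a, b, hab⟩ := h.exists_block_apply_ne_zero (i := 0) (j := d - 2) (by omega)
    exact hab (by rw [h0 _ _ (by omega), Matrix.zero_apply])
  have hle : muMinus S ≤ 1 := by
    refine muMinus_le_one_of_hyperplane h.symm (embBlock 0 u) fun ξ hξ => ?_
    rw [embBlock_dotProduct] at hξ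
    rw [form_eq_sum_blocks S hF.shape]
    simp only [Finset.sum_range_succ, Finset.sum_range_zero, zero_add,
      hF.shape 1 2 (by norm_num), hF.shape 2 1 (by norm_num), hF.shape 2 2 (by norm_num),
      zero_mulVec, dotProduct_zero, add_zero]
    let x : Fin g → ℝ := compBlock ξ 0
    let z : Fin g × Fin g → ℝ := compBlock ξ 1
    let w : Fin g × Fin g × Fin g → ℝ := compBlock ξ 2
    change 0 ≤ x ⬝ᵥ block00 S *ᵥ x + x ⬝ᵥ block01 S *ᵥ z + x ⬝ᵥ block02 S *ᵥ w +
      (z ⬝ᵥ block10 S *ᵥ x + z ⬝ᵥ block11 S *ᵥ z) + w ⬝ᵥ block20 S *ᵥ x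
    have hx : u ⬝ᵥ x = 0 := hξ
    have h02 : x ⬝ᵥ block02 S *ᵥ w = 0 := by
      rw [hF.z02, vecMulVec_mulVec, dotProduct_smul, dotProduct_comm x, hx, smul_zero]
    have h20 : w ⬝ᵥ block20 S *ᵥ x = 0 := by
      rw [hF.z20, mulVec_transpose, dotProduct_comm, ← dotProduct_mulVec, h02]
    have h10 : z ⬝ᵥ block10 S *ᵥ x = x ⬝ᵥ block01 S *ᵥ z := by
      rw [hF.z10, mulVec_transpose, dotProduct_comm, ← dotProduct_mulVec]
    have hE := (posSemidef_iff_quadratic (matE1_transpose h.block00_transpose hF.A_symm)).1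
      hF.E1_psd (Sum.elim x ((kronOne u)ᵀ *ᵥ z))
    rw [matE1_form_of_perp hF.z01 hF.z11 hx] at hE
    linarith
  omega

/-- The words of `𝒵₁₁` have length four, so `𝒵₁₁ = 0` and `A = 0`. A positive semidefinite matrix
with a zero diagonal block has zero blocks beside it, so `mat_g v = 0`. -/
theorem eq_zero_of_hasForm_of_three (h : IsWordMatrix T S) (hd : d = 3) {u y : Fin g → ℝ}
    {v : Fin g × Fin g → ℝ} {A : Matrix (Fin g) (Fin g) ℝ} (hF : HasForm S u y v A) :
    A = 0 ∧ A.vec = 0 ∧ v = 0 := by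
  have h11 : block11 S = 0 := h.block_eq_zero (i := 1) (j := 1) (by omega)
  have hA : A = 0 := by
    have := hF.A_eq
    rwa [h11, Matrix.mul_zero, Matrix.zero_mul] at this
  refine ⟨hA, by rw [hA, Matrix.vec_zero], ?_⟩
  have hE := matE1_transpose (u := u) (v := v) h.block00_transpose hF.A_symm
  have hpos := (posSemidef_iff_quadratic hE).1 hF.E1_psd
  have hv : ∀ η ζ : Fin g → ℝ, ζ ⬝ᵥ matG v *ᵥ η = 0 := by
    intro η ζ
    have h0 := dotProduct_mulVec_eq_zero_of_null hE (W := ⊤) (fun x _ => hpos x)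
      (f := Sum.elim 0 ζ) (x := Sum.elim η 0) Submodule.mem_top Submodule.mem_top
      (by rw [matE1_form, hA]; simp)
    rw [dotProduct_mulVec_comm_of_symm hE, matE1, fromBlocks_mulVec,
      sumElim_dotProduct_sumElim] at h0
    simpa using h0
  funext k
  simpa [matG] using hv (Pi.single k.1 1) (Pi.single k.2 1)

end IsWordMatrix

end NCHessian

end

theorem theorem1p7 (g : ℕ) (p : NCHessian.NCPoly g) (hp : star p = p)
    (Z : Matrix (NCHessian.BIdx g (NCHessian.ncDegree p))
      (NCHessian.BIdx g (NCHessian.ncDegree p)) (NCHessian.NCPoly g))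
    (hZ : NCHessian.IsMiddleMatrix p Z) :
    -- (I) degree at least three
    (3 ≤ NCHessian.ncDegree p →
      (NCHessian.muMinus (NCHessian.evalZero Z) = 1 ↔
        ∃ (u y : Fin g → ℝ) (v : Fin g × Fin g → ℝ) (A : Matrix (Fin g) (Fin g) ℝ),
          NCHessian.HasForm (NCHessian.evalZero Z) u y v A)) ∧
    -- (I), moreover: degree three
    (NCHessian.ncDegree p = 3 →
      ∀ (u y : Fin g → ℝ) (v : Fin g × Fin g → ℝ) (A : Matrix (Fin g) (Fin g) ℝ),
        NCHessian.HasForm (NCHessian.evalZero Z) u y v A → A = 0 ∧ A.vec = 0 ∧ v = 0) ∧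
    -- (II) degree two
    (NCHessian.ncDegree p = 2 →
      (NCHessian.muMinus (NCHessian.evalZero Z) = 1 ↔
        (∀ i j, 1 ≤ i + j → NCHessian.block (NCHessian.evalZero Z) i j = 0) ∧
        ∃ u : Fin g → ℝ, u ⬝ᵥ u = 1 ∧
          (∃ lam : ℝ, lam < 0 ∧ NCHessian.block00 (NCHessian.evalZero Z) *ᵥ u = lam • u) ∧
          (NCHessian.projPerp u * NCHessian.block00 (NCHessian.evalZero Z) *
            NCHessian.projPerp u).PosSemidef)) ∧
    -- (III) no negative eigenvalue
    (NCHessian.muMinus (NCHessian.evalZero Z) = 0 ↔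
      (∀ i j, 1 ≤ i + j → NCHessian.block (NCHessian.evalZero Z) i j = 0) ∧
      (NCHessian.block00 (NCHessian.evalZero Z)).PosSemidef) := by
  have h := NCHessian.isWordMatrix_evalZero hp hZ
  exact ⟨fun hd => ⟨h.exists_hasForm hd, fun ⟨_, _, _, _, hF⟩ => h.muMinus_eq_one_of_hasForm hd hF⟩,
    fun hd _ _ _ _ hF => h.eq_zero_of_hasForm_of_three hd hF,
    h.muMinus_eq_one_iff_of_two, h.muMinus_eq_zero_iff⟩
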